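/- Let $p$ be a prime, $G$ a finite group, and $\mathcal{C}$ a non-empty collection of $p$-subgroups of $G$, that is, a non-empty set of $p$-subgroups of $G$ (the trivial subgroup is allowed) closed under $G$-conjugation. Call a $p$-subgroup $P \le G$ \emph{$p$-radical} if $O_p(N_G(P)) = P$, where $O_p(H)$ denotes the largest normal $p$-subgroup of $H$. Suppose that $\mathcal{C}$ is closed under passage to $p$-radical $p$-overgroups: if $P \in \mathcal{C}$ and $Q$ is a $p$-radical $p$-subgroup of $G$ with $P \le Q$, then $Q \in \mathcal{C}$. Let $|\mathcal{C}|$ be the nerve of the poset $\mathcal{C}$ ordered by inclusion, on which $G$ acts by conjugation. Then the orbit space $|\mathcal{C}|/G$ is contractible; that is, the geometric realization of the simplicial set obtained from the nerve $|\mathcal{C}|$ by passing to $G$-orbits of $n$-simplices for every $n$ is a contractible topological space. -/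

import Mathlib

open CategoryTheory Opposite
open scoped Pointwise

universe u

section GPoset

variable (G : Type u) [Group G] (X : Type u) [PartialOrder X] [MulAction G X]
  [CovariantClass G X HSMul.hSMul LE.le]

/-- Translation by `g` on a `G`-poset, as a functor. -/
def gPosetFunctor (g : G) : X ⥤ X :=
  Monotone.functor (f := fun x : X => g • x) (fun _ _ h => smul_mono_right g h)

/-- The action of `G` on the `n`-simplices `x₀ ≤ ⋯ ≤ xₙ` of the nerve of a `G`-poset:
`g • (x₀ ≤ ⋯ ≤ xₙ) = (g • x₀ ≤ ⋯ ≤ g • xₙ)`. -/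
instance nerveMulAction (n : SimplexCategoryᵒᵖ) : MulAction G ((nerve X).obj n) where
  smul g s := (nerveMap (gPosetFunctor G X g)).app n s
  one_smul s := nerve.ext_of_isThin (funext fun i => one_smul G (s.obj i))
  mul_smul g h s := nerve.ext_of_isThin (funext fun i => mul_smul g h (s.obj i))

/-- The orbit space `|X|/G` of a `G`-poset `X`, as a simplicial set: the quotient of the nerve
of `X` by the action of `G`, dimension by dimension. -/
def orbitNerve : SSet.{u} where
  obj n := MulAction.orbitRel.Quotient G ((nerve X).obj n)
  map f := TypeCat.ofHom (Quotient.map ((nerve X).map f) (by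
    rintro _ t ⟨g, rfl⟩
    exact ⟨g, rfl⟩))
  map_id n := by
    ext x
    induction x using Quotient.inductionOn with | _ s => rfl
  map_comp f g := by
    ext x
    induction x using Quotient.inductionOn with | _ s => rfl

end GPoset

section Collections

variable (p : ℕ) (G : Type u) [Group G]

/-- `O_p(G)`, the largest normal `p`-subgroup of `G`. -/
def pCore : Subgroup G :=
  sSup {K : Subgroup G | K.Normal ∧ IsPGroup p K}

variable {G}

/-- A `p`-radical subgroup of `G`: a `p`-subgroup `P` with `O_p(N_G(P)) = P`. -/
def IsPRadicalSubgroup (P : Subgroup G) : Prop :=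
  IsPGroup p P ∧ (pCore p (Subgroup.normalizer (P : Set G))).map
    (Subgroup.normalizer (P : Set G)).subtype = P

variable (G)

/-- A collection of `p`-subgroups of `G`: a set of `p`-subgroups closed under conjugation. -/
structure PSubgroupCollection where
  carrier : Set (Subgroup G)
  isPGroup : ∀ P ∈ carrier, IsPGroup p P
  conj_mem : ∀ (g : G), ∀ P ∈ carrier, MulAut.conj g • P ∈ carrier

namespace PSubgroupCollection

variable {p G} (C : PSubgroupCollection p G)

/-- The collection is closed under passage to `p`-radical `p`-overgroups. -/
def ClosedUnderPRadicalOvergroups : Prop :=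
  ∀ P ∈ C.carrier, ∀ Q : Subgroup G, P ≤ Q → IsPRadicalSubgroup p Q → Q ∈ C.carrier

/-- `G` acts on the poset `C` (ordered by inclusion) by conjugation. -/
instance : MulAction G C.carrier where
  smul g P := ⟨MulAut.conj g • P.1, C.conj_mem g P.1 P.2⟩
  one_smul P := Subtype.ext (by
    change MulAut.conj (1 : G) • P.1 = P.1
    rw [map_one, one_smul])
  mul_smul g h P := Subtype.ext (by
    change MulAut.conj (g * h) • P.1 = MulAut.conj g • MulAut.conj h • P.1
    rw [map_mul, mul_smul])

instance : CovariantClass G C.carrier HSMul.hSMul LE.le where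
  elim _ _ _ h := Subgroup.map_mono (show _ ≤ _ from h)

/-- The orbit space `|C|/G` of the nerve of the poset `C` under conjugation, as a simplicial set. -/
def orbitSpace : SSet.{u} := orbitNerve G C.carrier

end PSubgroupCollection

end Collections

/-! Let `D` be the collection of all `p`-subgroups containing a member of `C`. It is closed under
all `p`-overgroups and contains both `C` and the Sylow subgroups. The inclusions of the orbit spaces
of the Sylow collection and of `C` into that of `D` are both anodyne. The first orbit space is a
point by Sylow's theorem, so that of `D` has an anodyne vertex and is contractible; that of `C`
realizes to a retract of it, hence is contractible too.

Anodyne extensions come from acyclic matchings, as in discrete Morse theory. An `OrbitToggle`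
matches orbits of chains not contained in a subposet by inserting or removing one element,
determined up to the stabilizer of the chain; a rank that drops makes the matching acyclic, so the
matched pairs are attached by filling horns.

For Sylow subgroups, let `T` be the largest member of the chain normalising all members below it.
The toggled element is a Sylow `p`-subgroup of the group that normalises the members up to `T` and
lies in the later ones. It is unique only up to conjugacy, so the matching lives on orbits.

For `C`, let `P` be the smallest member of the chain outside `C`. By hypothesis it is not
`p`-radical, so `P < O_p(N_G(P))`. If some member does not normalise `P`, the smallest such `Q`
gives the toggled element `Q ∩ N_G(P)`. Otherwise it is `Q O_p(N_G(P))`, with `Q` the largest member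
not containing `O_p(N_G(P))`. -/

/-! ### Horn retractions and the path fibration -/

section HornRetraction

open Topology Simplicial

/-- The union of the faces of the topological simplex opposite to the vertices `j ≠ k`. -/
def topHorn {n : ℕ} (k : Fin (n + 2)) : Set (stdSimplex ℝ (Fin (n + 2))) :=
  {x | ∃ j, j ≠ k ∧ x j = 0}

/-- The smallest barycentric coordinate with index different from `k`. -/
noncomputable def hornDepth {n : ℕ} (k : Fin (n + 2)) (x : stdSimplex ℝ (Fin (n + 2))) : ℝ :=
  (Finset.univ.erase k).inf' (by
    obtain ⟨j, hj⟩ := exists_ne k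
    exact ⟨j, by simpa using hj⟩) (fun j => x j)

lemma continuous_stdSimplex_apply {ι : Type*} [Fintype ι] (j : ι) :
    Continuous (fun x : stdSimplex ℝ ι => x j) :=
  (continuous_apply j).comp continuous_subtype_val

lemma continuous_hornDepth {n : ℕ} (k : Fin (n + 2)) : Continuous (hornDepth k) :=
  Continuous.finset_inf'_apply _ fun j _ => continuous_stdSimplex_apply j

lemma hornDepth_le {n : ℕ} {k j : Fin (n + 2)} (hj : j ≠ k)
    (x : stdSimplex ℝ (Fin (n + 2))) : hornDepth k x ≤ x j :=
  Finset.inf'_le _ (by simpa using hj)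

lemma hornDepth_nonneg {n : ℕ} (k : Fin (n + 2)) (x : stdSimplex ℝ (Fin (n + 2))) :
    0 ≤ hornDepth k x :=
  Finset.le_inf' _ _ fun j _ => x.2.1 j

lemma exists_eq_hornDepth {n : ℕ} (k : Fin (n + 2)) (x : stdSimplex ℝ (Fin (n + 2))) :
    ∃ j, j ≠ k ∧ x j = hornDepth k x := by
  obtain ⟨j, hj, h⟩ := Finset.exists_mem_eq_inf' (s := Finset.univ.erase k) (by
    obtain ⟨j, hj⟩ := exists_ne k
    exact ⟨j, by simpa using hj⟩) (fun j => x j)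
  exact ⟨j, by simpa using hj, h.symm⟩

lemma hornDepth_eq_zero {n : ℕ} {k : Fin (n + 2)} {x : stdSimplex ℝ (Fin (n + 2))}
    (hx : x ∈ topHorn k) : hornDepth k x = 0 := by
  obtain ⟨j, hj, h⟩ := hx
  exact le_antisymm ((hornDepth_le hj x).trans h.le) (hornDepth_nonneg k x)

/-- Move the point `x` away from the `k`-th face towards the horn, lowering every coordinate
different from the `k`-th one by `t`. -/
noncomputable def hornPush {n : ℕ} (k : Fin (n + 2)) (x : stdSimplex ℝ (Fin (n + 2))) (t : ℝ) :
    stdSimplex ℝ (Fin (n + 2)) :=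
  -- Truncating `t` to `[0, hornDepth k x]` keeps all coordinates nonnegative. The `k`-th one is
  -- lowered too by the first term, hence `n + 2` and not `n + 1`.
  ⟨fun j => x j - min (max t 0) (hornDepth k x) +
    if j = k then (n + 2) * min (max t 0) (hornDepth k x) else 0, by
    have h0 : 0 ≤ min (max t 0) (hornDepth k x) :=
      le_min (le_max_right _ _) (hornDepth_nonneg k x)
    have h1 : min (max t 0) (hornDepth k x) ≤ hornDepth k x := min_le_right _ _
    generalize min (max t 0) (hornDepth k x) = s at h0 h1
    constructor
    · intro j
      change 0 ≤ x j - s + if j = k then (n + 2) * s else 0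
      split_ifs with h
      · have := x.2.1 j
        have : 0 ≤ x j := this
        have : 0 ≤ (n : ℝ) * s := by positivity
        linarith
      · have := hornDepth_le h x
        linarith
    · have : ∑ j, x j = 1 := x.2.2
      simp [Finset.sum_add_distrib, Finset.sum_sub_distrib, this]⟩

lemma continuous_hornPush {n : ℕ} (k : Fin (n + 2)) :
    Continuous (fun q : stdSimplex ℝ (Fin (n + 2)) × ℝ => hornPush k q.1 q.2) := by
  refine Continuous.subtype_mk (continuous_pi fun j => ?_) _
  have h : Continuous fun q : stdSimplex ℝ (Fin (n + 2)) × ℝ =>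
      min (max q.2 0) (hornDepth k q.1) :=
    (continuous_snd.max continuous_const).min ((continuous_hornDepth k).comp continuous_fst)
  have h' : Continuous fun q : stdSimplex ℝ (Fin (n + 2)) × ℝ => q.1 j :=
    (continuous_stdSimplex_apply j).comp continuous_fst
  split_ifs
  · fun_prop
  · fun_prop

lemma hornPush_of_min_eq_zero {n : ℕ} {k : Fin (n + 2)} {x : stdSimplex ℝ (Fin (n + 2))} {t : ℝ}
    (h : min (max t 0) (hornDepth k x) = 0) : hornPush k x t = x := by
  ext j
  change x j - min (max t 0) (hornDepth k x) +
    (if j = k then (n + 2) * min (max t 0) (hornDepth k x) else 0) = x j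
  simp [h]

lemma hornPush_zero {n : ℕ} (k : Fin (n + 2)) (x : stdSimplex ℝ (Fin (n + 2))) :
    hornPush k x 0 = x :=
  hornPush_of_min_eq_zero (by simpa using hornDepth_nonneg k x)

lemma hornPush_of_mem {n : ℕ} {k : Fin (n + 2)} {x : stdSimplex ℝ (Fin (n + 2))}
    (hx : x ∈ topHorn k) (t : ℝ) : hornPush k x t = x :=
  hornPush_of_min_eq_zero (by simp [hornDepth_eq_zero hx])

lemma hornPush_hornDepth_mem {n : ℕ} (k : Fin (n + 2)) (x : stdSimplex ℝ (Fin (n + 2))) :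
    hornPush k x (hornDepth k x) ∈ topHorn k := by
  obtain ⟨j, hj, h⟩ := exists_eq_hornDepth k x
  refine ⟨j, hj, ?_⟩
  change x j - min (max (hornDepth k x) 0) (hornDepth k x) + (if j = k then _ else 0) = 0
  simp [hj, h]

/-- The retraction of the simplex onto the horn. -/
noncomputable def hornRetraction {n : ℕ} (k : Fin (n + 2)) :
    C(stdSimplex ℝ (Fin (n + 2)), topHorn k) where
  toFun x := ⟨hornPush k x (hornDepth k x), hornPush_hornDepth_mem k x⟩
  continuous_toFun := Continuous.subtype_mk
    ((continuous_hornPush k).comp (continuous_id.prodMk (continuous_hornDepth k))) _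

lemma hornRetraction_of_mem {n : ℕ} {k : Fin (n + 2)} (x : topHorn k) :
    hornRetraction k x.1 = x :=
  Subtype.ext (hornPush_of_mem x.2 _)

/-- A continuous map has the lifting property for the inclusions of topological horns. -/
def HasHornLifts {E B : Type*} [TopologicalSpace E] [TopologicalSpace B] (p : C(E, B)) : Prop :=
  ∀ ⦃n : ℕ⦄ (k : Fin (n + 2)) (H : C(topHorn k, E)) (f : C(stdSimplex ℝ (Fin (n + 2)), B)),
    (∀ x : topHorn k, p (H x) = f x.1) →
      ∃ F : C(stdSimplex ℝ (Fin (n + 2)), E), (∀ x : topHorn k, F x.1 = H x) ∧ ∀ x, p (F x) = f x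

/-- The space of paths starting at a given point. -/
abbrev PathsFrom {Y : Type*} [TopologicalSpace Y] (y : Y) : Type _ :=
  {γ : C(unitInterval, Y) // γ 0 = y}

/-- The end point of a path. -/
def PathsFrom.target {Y : Type*} [TopologicalSpace Y] (y : Y) : C(PathsFrom y, Y) where
  toFun γ := γ.1 1
  continuous_toFun := (continuous_eval_const (1 : unitInterval)).comp continuous_subtype_val

lemma hasHornLifts_of_subsingleton {E B : Type*} [TopologicalSpace E] [TopologicalSpace B]
    [Subsingleton B] (p : C(E, B)) : HasHornLifts p := fun _ k H _ _ =>
  ⟨H.comp (hornRetraction k), fun x => by simp [hornRetraction_of_mem],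
    fun _ => Subsingleton.elim _ _⟩

/-- The path over `x` follows `H` at the retracted point `r(x)` during time `1`, then the image
under `f` of the segment from `r(x)` back to `x` during time `hornDepth k x`; `τ` rescales the total
time to the unit interval. On the horn the depth is `0`, so the path is exactly `H x`. -/
lemma hasHornLifts_pathsFrom_target {Y : Type*} [TopologicalSpace Y] (y : Y) :
    HasHornLifts (PathsFrom.target y) := by
  intro n k H f hf
  let X := stdSimplex ℝ (Fin (n + 2))
  let τ : X × unitInterval → ℝ := fun q => (1 + hornDepth k q.1) * q.2
  have hτ : Continuous τ :=
    (continuous_const.add ((continuous_hornDepth k).comp continuous_fst)).mul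
      (continuous_subtype_val.comp continuous_snd)
  let K : X × unitInterval → Y := fun q => if τ q ≤ 1
    then (H (hornRetraction k q.1)).1 (Set.projIcc 0 1 zero_le_one (τ q))
    else f (hornPush k q.1 (hornDepth k q.1 - (τ q - 1)))
  have hK : Continuous K := by
    refine Continuous.if_le ?_ ?_ hτ continuous_const ?_
    · exact continuous_eval.comp ((continuous_subtype_val.comp (H.continuous.comp
        ((hornRetraction k).continuous.comp continuous_fst))).prodMk
          ((continuous_projIcc (h := zero_le_one)).comp hτ))
    · exact f.continuous.comp ((continuous_hornPush k).comp (continuous_fst.prodMk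
        (((continuous_hornDepth k).comp continuous_fst).sub (hτ.sub continuous_const))))
    · intro q hq
      have := hf (hornRetraction k q.1)
      simp only [hq, sub_self, sub_zero, Set.projIcc_right]
      exact this
  let F : C(X, C(unitInterval, Y)) := ContinuousMap.curry ⟨K, hK⟩
  have hF (x : X) (s : unitInterval) : F x s = K (x, s) := rfl
  have hF0 (x : X) : F x 0 = y := by
    have : τ (x, 0) = 0 := by simp [τ]
    simp only [hF, K, this, zero_le_one, if_true, Set.projIcc_left]
    exact (H _).2
  refine ⟨⟨fun x => ⟨F x, hF0 x⟩, F.continuous.subtype_mk _⟩, fun x => ?_, fun x => ?_⟩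
  · refine Subtype.ext (ContinuousMap.ext fun s => ?_)
    have : τ (x.1, s) = s := by simp [τ, hornDepth_eq_zero x.2]
    change K (x.1, s) = _
    simp [K, this, s.2.2, hornRetraction_of_mem]
  · change K (x, 1) = f x
    have h1 : τ (x, 1) = 1 + hornDepth k x := by simp [τ]
    rcases (hornDepth_nonneg k x).eq_or_lt with h | h
    · have hx : x ∈ topHorn k := by
        obtain ⟨j, hj, hx⟩ := exists_eq_hornDepth k x
        exact ⟨j, hj, hx.trans h.symm⟩
      have := hf ⟨x, hx⟩
      have h2 := hornRetraction_of_mem ⟨x, hx⟩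
      simp only at h2
      simp only [K, h1, ← h, add_zero, le_refl, if_true, Set.projIcc_right, h2]
      exact this
    · simp [K, h1, h, hornPush_zero]

end HornRetraction

/-! ### Kan fibrations from topological horn lifts -/

section SingularLifting

open Topology Simplicial SSet HomotopicalAlgebra

lemma stdSimplex_map_apply_of_injective {ι κ : Type*} [Fintype ι] [Fintype κ] {f : ι → κ}
    (hf : Function.Injective f) (x : stdSimplex ℝ ι) (i : ι) :
    stdSimplex.map f x (f i) = x i := by
  classical
  rw [stdSimplex.map_coe, FunOnFinite.linearMap_apply_apply]
  have : (Finset.univ.filter fun a => f a = f i) = {i} := by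
    ext a
    simp [hf.eq_iff]
  simp [this]

lemma stdSimplex_map_apply_of_notMem {ι κ : Type*} [Fintype ι] [Fintype κ] {f : ι → κ}
    (x : stdSimplex ℝ ι) {j : κ} (hj : j ∉ Set.range f) : stdSimplex.map f x j = 0 := by
  classical
  rw [stdSimplex.map_coe, FunOnFinite.linearMap_apply_apply]
  refine Finset.sum_eq_zero fun a ha => (hj ⟨a, ?_⟩).elim
  simpa using ha

lemma stdSimplex_map_injective {ι κ : Type*} [Fintype ι] [Fintype κ] {f : ι → κ}
    (hf : Function.Injective f) :
    Function.Injective (stdSimplex.map f : stdSimplex ℝ ι → stdSimplex ℝ κ) := by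
  intro x y h
  ext i
  have := congrArg (fun z : stdSimplex ℝ κ => z (f i)) h
  simpa only [stdSimplex_map_apply_of_injective hf] using this

lemma exists_stdSimplex_map_eq {ι κ : Type*} [Fintype ι] [Fintype κ] {f : ι → κ}
    (hf : Function.Injective f) (x : stdSimplex ℝ κ) (hx : ∀ j, j ∉ Set.range f → x j = 0) :
    ∃ v : stdSimplex ℝ ι, stdSimplex.map f v = x := by
  classical
  refine ⟨⟨fun i => x (f i), fun i => x.2.1 _, ?_⟩, ?_⟩
  · have h1 : ∑ j, x j = 1 := x.2.2
    rw [← h1]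
    exact Fintype.sum_of_injective f hf _ _ (fun j hj => hx j hj) fun _ => rfl
  · ext j
    by_cases hj : j ∈ Set.range f
    · obtain ⟨i, rfl⟩ := hj
      exact stdSimplex_map_apply_of_injective hf _ i
    · rw [hx j hj]
      exact stdSimplex_map_apply_of_notMem _ hj

/-- A monotone map `Fin (m + 1) → Fin (n + 2)` avoiding `j` factors through the `j`-th coface. -/
lemma exists_comp_δ_eq {m n : ℕ} (e : ⦋m⦌ ⟶ ⦋n + 1⦌) (j : Fin (n + 2))
    (h : ∀ i, e.toOrderHom i ≠ j) : ∃ β : ⦋m⦌ ⟶ ⦋n⦌, β ≫ SimplexCategory.δ j = e := by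
  have h' (i) : ∃ a, j.succAbove a = e.toOrderHom i := Fin.exists_succAbove_eq (h i)
  choose b hb using h'
  refine ⟨SimplexCategory.Hom.mk ⟨b, fun i i' hi => ?_⟩, ?_⟩
  · have := e.toOrderHom.monotone hi
    rw [← hb, ← hb] at this
    exact (Fin.strictMono_succAbove j).le_iff_le.1 this
  · ext i
    exact congrArg Fin.val (hb i)

variable {Y : TopCat.{u}} {n : ℕ} {k : Fin (n + 2)}

/-- The `j`-th face of a map from a horn to a singular simplicial set, as a continuous map. -/
noncomputable def hornFaceMap (φ : (Λ[n + 1, k] : SSet.{u}) ⟶ TopCat.toSSet.obj Y)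
    (j : Fin (n + 2)) (hj : j ≠ k) : C(stdSimplex ℝ (Fin (n + 1)), Y) :=
  Y.toSSetObjEquiv _ (φ.app _ (horn.face k j hj))

lemma hornFaceMap_map (φ : (Λ[n + 1, k] : SSet.{u}) ⟶ TopCat.toSSet.obj Y)
    (j : Fin (n + 2)) (hj : j ≠ k) {m : ℕ} (β : ⦋m⦌ ⟶ ⦋n⦌) (v : stdSimplex ℝ (Fin (m + 1))) :
    hornFaceMap φ j hj (stdSimplex.map β.toOrderHom v) =
      Y.toSSetObjEquiv (op ⦋m⦌) (φ.app _ ((Λ[n + 1, k] : SSet.{u}).map β.op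
        (horn.face k j hj))) v := by
  have h := NatTrans.naturality_apply φ β.op (horn.face k j hj)
  rw [h]
  rfl

/-- The support `S` of the common point avoids both `j` and `j'`, so the face it spans factors
through both cofaces. Both sides are then values of `φ` on this one simplex of the horn. -/
lemma hornFaceMap_compatible (φ : (Λ[n + 1, k] : SSet.{u}) ⟶ TopCat.toSSet.obj Y)
    (j j' : Fin (n + 2)) (hj : j ≠ k) (hj' : j' ≠ k) (w w' : stdSimplex ℝ (Fin (n + 1)))
    (h : stdSimplex.map j.succAbove w = stdSimplex.map j'.succAbove w') :
    hornFaceMap φ j hj w = hornFaceMap φ j' hj' w' := by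
  classical
  set x := stdSimplex.map j.succAbove w with hx
  have hxj : x j = 0 := stdSimplex_map_apply_of_notMem _ (by simp)
  have hxj' : x j' = 0 := by
    rw [h]; exact stdSimplex_map_apply_of_notMem _ (by simp)
  let S : Finset (Fin (n + 2)) := Finset.univ.filter fun i => x i ≠ 0
  obtain ⟨m, hm⟩ : ∃ m, S.card = m + 1 := by
    refine Nat.exists_eq_succ_of_ne_zero fun h0 => ?_
    rw [Finset.card_eq_zero] at h0
    have h1 : ∑ i, x i = 1 := x.2.2
    have h2 (i) : x i = 0 := by
      by_contra hi
      have : i ∈ S := by simp [S, hi]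
      simp [h0] at this
    simp [h2] at h1
  let e : ⦋m⦌ ⟶ ⦋n + 1⦌ := SimplexCategory.Hom.mk (S.orderEmbOfFin hm).toOrderHom
  have he (i) : e.toOrderHom i ∈ S := S.orderEmbOfFin_mem hm i
  let e' : Fin (m + 1) → Fin (n + 2) := S.orderEmbOfFin hm
  have hinj : Function.Injective e' := (S.orderEmbOfFin hm).injective
  obtain ⟨v, hv⟩ := exists_stdSimplex_map_eq hinj x (fun i hi => by
    by_contra h0
    refine hi ?_
    have : i ∈ Set.range (S.orderEmbOfFin hm) := by
      rw [Finset.range_orderEmbOfFin]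
      simp [S, h0]
    exact this)
  obtain ⟨β, hβ⟩ := exists_comp_δ_eq e j fun i hi => by
    have := he i
    simp [S, hi, hxj] at this
  obtain ⟨β', hβ'⟩ := exists_comp_δ_eq e j' fun i hi => by
    have := he i
    simp [S, hi, hxj'] at this
  have key (a : Fin (n + 2)) (γ : ⦋m⦌ ⟶ ⦋n⦌) (hγ : γ ≫ SimplexCategory.δ a = e)
      (z : stdSimplex ℝ (Fin (n + 1))) (hz : stdSimplex.map a.succAbove z = x) :
      stdSimplex.map γ.toOrderHom v = z := by
    let γ' : Fin (m + 1) → Fin (n + 1) := γ.toOrderHom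
    have h1 : e' = a.succAbove ∘ γ' := by
      change ⇑e.toOrderHom = _
      rw [← hγ, SimplexCategory.comp_toOrderHom]
      rfl
    change stdSimplex.map γ' v = z
    apply stdSimplex_map_injective (Fin.succAbove_right_injective (p := a))
    rw [hz, ← hv, h1, stdSimplex.map_comp_apply]
  rw [← key j β hβ w rfl, ← key j' β' hβ' w' h.symm, hornFaceMap_map, hornFaceMap_map]
  congr 3
  refine Subtype.ext ?_
  change stdSimplex.objEquiv.symm (β ≫ SimplexCategory.δ j) =
    stdSimplex.objEquiv.symm (β' ≫ SimplexCategory.δ j')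
  rw [hβ, hβ']

/-- A map from a horn to a singular simplicial set comes from a continuous map defined on the
topological horn. -/
lemma exists_topHorn_map (φ : (Λ[n + 1, k] : SSet.{u}) ⟶ TopCat.toSSet.obj Y) :
    ∃ g : C(topHorn k, Y), ∀ (j : Fin (n + 2)) (hj : j ≠ k) (w : stdSimplex ℝ (Fin (n + 1)))
      (x : topHorn k), x.1 = stdSimplex.map j.succAbove w → g x = hornFaceMap φ j hj w := by
  have hmem (j : {j : Fin (n + 2) // j ≠ k}) (w : stdSimplex ℝ (Fin (n + 1))) :
      stdSimplex.map j.1.succAbove w ∈ topHorn k :=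
    ⟨j.1, j.2, stdSimplex_map_apply_of_notMem _ (by simp)⟩
  let q : C((_ : {j : Fin (n + 2) // j ≠ k}) × stdSimplex ℝ (Fin (n + 1)), topHorn k) :=
    { toFun a := ⟨stdSimplex.map a.1.1.succAbove a.2, hmem a.1 a.2⟩
      continuous_toFun := continuous_sigma fun j =>
        (stdSimplex.continuous_map j.1.succAbove).subtype_mk _ }
  have : CompactSpace (stdSimplex ℝ (Fin (n + 1))) :=
    isCompact_iff_compactSpace.1 (isCompact_stdSimplex ℝ (Fin (n + 1)))
  -- The faces form a compact space mapping onto the Hausdorff horn, so maps that agree on overlaps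
  -- glue.
  have hq : IsQuotientMap q := by
    refine q.continuous.isClosedMap.isQuotientMap q.continuous ?_
    rintro ⟨x, j, hj, hx⟩
    obtain ⟨v, hv⟩ := exists_stdSimplex_map_eq (Fin.succAbove_right_injective (p := j)) x
      (fun i hi => by
        have : i = j := by simpa using hi
        rw [this, hx])
    exact ⟨⟨⟨j, hj⟩, v⟩, Subtype.ext hv⟩
  let g₀ : C((_ : {j : Fin (n + 2) // j ≠ k}) × stdSimplex ℝ (Fin (n + 1)), Y) :=
    { toFun a := hornFaceMap φ a.1.1 a.1.2 a.2
      continuous_toFun := continuous_sigma fun j => (hornFaceMap φ j.1 j.2).continuous }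
  have hg : Function.FactorsThrough g₀ q := fun a b hab =>
    hornFaceMap_compatible φ _ _ _ _ _ _ (congrArg Subtype.val hab)
  refine ⟨hq.lift g₀ hg, fun j hj w x hx => ?_⟩
  have h1 : q ⟨⟨j, hj⟩, w⟩ = x := Subtype.ext hx.symm
  have h2 := congrArg (fun f : C(_, Y) => f ⟨⟨j, hj⟩, w⟩) (hq.lift_comp g₀ hg)
  rw [← h1]
  exact h2

/-- The singular simplicial set functor turns maps with horn lifts into Kan fibrations. -/
lemma fibrations_toSSet_map {E B : TopCat.{u}} (p : E ⟶ B) (hp : HasHornLifts p.hom) :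
    modelCategoryQuillen.J.rlp (TopCat.toSSet.map p) := by
  intro _ _ i hi
  simp only [modelCategoryQuillen.J, MorphismProperty.iSup_iff] at hi
  obtain ⟨n, ⟨k⟩⟩ := hi
  refine ⟨fun {φ b} sq => ?_⟩
  obtain ⟨g, hg⟩ := exists_topHorn_map φ
  let f : C(stdSimplex ℝ (Fin (n + 2)), B) := B.toSSetObjEquiv (op ⦋n + 1⦌) (yonedaEquiv b)
  have hb : b = yonedaEquiv.symm ((B.toSSetObjEquiv (op ⦋n + 1⦌)).symm f) := by simp [f]
  have hface (j : Fin (n + 2)) (hj : j ≠ k) (w : stdSimplex ℝ (Fin (n + 1))) :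
      p.hom (hornFaceMap φ j hj w) = f (stdSimplex.map j.succAbove w) := by
    have h1 := congrArg (fun ψ => ψ.app _ (horn.face k j hj)) sq.w
    have h2 := congrArg (fun s => B.toSSetObjEquiv (op ⦋n⦌) s w) h1
    refine Eq.trans (Eq.trans rfl h2) ?_
    have h3 : b.app (op ⦋n⦌) (horn.face k j hj).1 =
        (TopCat.toSSet.obj B).map (SimplexCategory.δ j).op (yonedaEquiv b) := by
      have := NatTrans.naturality_apply b (SimplexCategory.δ j).op
        (stdSimplex.objEquiv.symm (𝟙 ⦋n + 1⦌))
      exact this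
    refine Eq.trans (congrArg (fun s => B.toSSetObjEquiv (op ⦋n⦌) s w) h3) ?_
    rfl
  obtain ⟨F, hF, hpF⟩ := hp k g f (fun x => by
    obtain ⟨x, j, hj, hx⟩ := x
    obtain ⟨w, hw⟩ := exists_stdSimplex_map_eq (Fin.succAbove_right_injective (p := j)) x
      (fun i hi => by
        have : i = j := by simpa using hi
        rw [this, hx])
    rw [hg j hj w _ hw.symm]
    exact (hface j hj w).trans (by rw [hw]))
  refine ⟨⟨⟨yonedaEquiv.symm ((E.toSSetObjEquiv (op ⦋n + 1⦌)).symm F), ?_, ?_⟩⟩⟩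
  · refine horn.hom_ext _ _ fun j hj => ?_
    apply (E.toSSetObjEquiv (op ⦋n⦌)).injective
    ext w
    refine Eq.trans ?_ (hg j hj w ⟨stdSimplex.map j.succAbove w,
      ⟨j, hj, stdSimplex_map_apply_of_notMem _ (by simp)⟩⟩ rfl)
    exact hF ⟨stdSimplex.map j.succAbove w, _⟩
  · rw [hb, yonedaEquiv_symm_comp]
    congr 1
    apply (B.toSSetObjEquiv (op ⦋n + 1⦌)).injective
    ext w
    exact hpF w

end SingularLifting

/-! ### Contractibility from anodyne extensions -/

section AnodyneContractible

open Topology Simplicial SSet HomotopicalAlgebra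

lemma SSet.anodyneExtensions.hasLiftingProperty {A X : SSet.{u}} {i : A ⟶ X}
    (hi : anodyneExtensions i) {E B : TopCat.{u}} (p : E ⟶ B) (hp : HasHornLifts p.hom) :
    HasLiftingProperty i (TopCat.toSSet.map p) := by
  rw [anodyneExtensions_eq_llp_rlp] at hi
  exact hi _ (fibrations_toSSet_map p hp)

/-- The realization of a simplicial set with an anodyne vertex is contractible. -/
theorem contractibleSpace_toTop_of_anodyneExtensions {X : SSet.{u}} (i : Δ[0] ⟶ X)
    (hi : anodyneExtensions i) : ContractibleSpace (SSet.toTop.obj X) := by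
  let Y : TopCat.{u} := SSet.toTop.obj X
  let y : Y := SSet.toTop.map i default
  let E : TopCat.{u} := TopCat.of (PathsFrom y)
  let p : E ⟶ Y := TopCat.ofHom (PathsFrom.target y)
  have := hi.hasLiftingProperty p (hasHornLifts_pathsFrom_target y)
  let e₀ : E := ⟨ContinuousMap.const _ y, rfl⟩
  have sq : CommSq (sSetTopAdj.homEquiv _ _ (TopCat.ofHom (ContinuousMap.const _ e₀))) i
      (TopCat.toSSet.map p) (sSetTopAdj.homEquiv X Y (𝟙 _)) := by
    constructor
    rw [← Adjunction.homEquiv_naturality_right, ← Adjunction.homEquiv_naturality_left]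
    congr 1
    ext x
    obtain rfl := Subsingleton.elim x default
    rfl
  -- A section of the path fibration: a continuous choice of a path from `y` to each point, that is,
  -- a contraction.
  let s : Y ⟶ E := (sSetTopAdj.homEquiv X E).symm sq.lift
  have hs : s ≫ p = 𝟙 Y := by
    rw [← Adjunction.homEquiv_naturality_right_symm, sq.fac_right, Equiv.symm_apply_apply]
  have hs' (x : Y) : (s.hom x).1 1 = x := congrArg (fun f : Y ⟶ Y => f.hom x) hs
  rw [contractible_iff_id_nullhomotopic]
  let γ : C(Y, C(unitInterval, Y)) :=
    ⟨fun x => (s.hom x).1, continuous_subtype_val.comp s.hom.continuous⟩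
  refine ⟨y, ⟨ContinuousMap.Homotopy.symm ⟨⟨fun q => γ q.2 q.1, ?_⟩, fun x => (s.hom x).2, hs'⟩⟩⟩
  exact continuous_eval.comp ((γ.continuous.comp continuous_snd).prodMk continuous_fst)

/-- If `A ⟶ X` is an anodyne extension and `X` has contractible realization, so has `A`. -/
theorem contractibleSpace_toTop_left_of_anodyneExtensions {A X : SSet.{u}} (i : A ⟶ X)
    (hi : anodyneExtensions i) [ContractibleSpace (SSet.toTop.obj X)] :
    ContractibleSpace (SSet.toTop.obj A) := by
  let p : SSet.toTop.obj A ⟶ TopCat.of PUnit.{u + 1} :=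
    TopCat.ofHom (ContinuousMap.const _ PUnit.unit)
  have := hi.hasLiftingProperty p (hasHornLifts_of_subsingleton p.hom)
  have sq : CommSq (sSetTopAdj.homEquiv A _ (𝟙 _)) i (TopCat.toSSet.map p)
      (sSetTopAdj.homEquiv X (TopCat.of PUnit.{u + 1})
        (TopCat.ofHom (ContinuousMap.const _ PUnit.unit))) := by
    constructor
    rw [← Adjunction.homEquiv_naturality_right, ← Adjunction.homEquiv_naturality_left]
    rfl
  -- Lifting the identity of `A` against a map to a point makes its realization a retract of that of
  -- `X`.
  let r : SSet.toTop.obj X ⟶ SSet.toTop.obj A := (sSetTopAdj.homEquiv X _).symm sq.lift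
  have hr : SSet.toTop.map i ≫ r = 𝟙 _ := by
    rw [← Adjunction.homEquiv_naturality_left_symm, sq.fac_left, Equiv.symm_apply_apply]
  have h1 : ContinuousMap.id _ = r.hom.comp ((ContinuousMap.id _).comp (SSet.toTop.map i).hom) :=
    congrArg TopCat.Hom.hom hr.symm
  rw [contractible_iff_id_nullhomotopic, h1]
  exact ((id_nullhomotopic _).comp_left _).comp_right _

end AnodyneContractible

/-! ### Simplices of the orbit space -/

section OrbitNerve

open Simplicial SSet

variable (G : Type u) [Group G] {X Y : Type u} [PartialOrder X] [MulAction G X]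
  [CovariantClass G X HSMul.hSMul LE.le] [PartialOrder Y] [MulAction G Y]
  [CovariantClass G Y HSMul.hSMul LE.le]

/-- The map of orbit spaces induced by an equivariant monotone map. -/
def orbitNerveMap (f : Y →o X) (hf : ∀ (g : G) y, f (g • y) = g • f y) :
    orbitNerve G Y ⟶ orbitNerve G X where
  app n := TypeCat.ofHom (Quotient.map ((nerveMap f.monotone.functor).app n) (by
    rintro _ t ⟨g, rfl⟩
    exact ⟨g, nerve.ext_of_isThin (funext fun i => (hf g (t.obj i)).symm)⟩))
  naturality m n φ := by
    ext x
    induction x using Quotient.inductionOn with | _ s => rfl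

/-- The orbit of a simplex of the nerve. -/
def orbitMk {n : SimplexCategoryᵒᵖ} (s : (nerve X).obj n) : (orbitNerve G X).obj n :=
  Quotient.mk _ s

lemma orbitMk_surjective {n : SimplexCategoryᵒᵖ} :
    Function.Surjective (orbitMk G : (nerve X).obj n → (orbitNerve G X).obj n) :=
  Quotient.mk_surjective

lemma orbitMk_eq_iff {n : SimplexCategoryᵒᵖ} (s t : (nerve X).obj n) :
    orbitMk G s = orbitMk G t ↔ ∃ g : G, g • t = s :=
  Quotient.eq

lemma orbitMk_smul {n : SimplexCategoryᵒᵖ} (g : G) (s : (nerve X).obj n) :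
    orbitMk G (g • s) = orbitMk G s :=
  (orbitMk_eq_iff G _ _).2 ⟨g, rfl⟩

lemma smul_obj {n : ℕ} (g : G) (s : (nerve X) _⦋n⦌) (i : Fin (n + 1)) :
    (g • s).obj i = g • s.obj i := rfl

lemma δ_smul {n : ℕ} (g : G) (s : (nerve X) _⦋n + 1⦌) (i : Fin (n + 2)) :
    (nerve X).δ i (g • s) = g • (nerve X).δ i s := rfl

lemma δ_orbitMk {n : ℕ} (i : Fin (n + 2)) (s : (nerve X) _⦋n + 1⦌) :
    (orbitNerve G X).δ i (orbitMk G s) = orbitMk G ((nerve X).δ i s) := rfl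

/-- The set of vertices of a simplex of the nerve. -/
def nerveVertices {n : ℕ} (s : (nerve X) _⦋n⦌) : Set X := Set.range s.obj

lemma nerveVertices_smul {n : ℕ} (g : G) (s : (nerve X) _⦋n⦌) :
    nerveVertices (g • s) = g • nerveVertices s :=
  Set.range_smul g s.obj

lemma strictMono_smul {n : ℕ} {s : (nerve X) _⦋n⦌} (hs : StrictMono s.obj) (g : G) :
    StrictMono (g • s).obj := fun _ _ hij =>
  lt_of_le_of_ne (smul_mono_right g (hs hij).le) fun h =>
    (hs hij).ne (MulAction.injective g h)

/-- Degeneracies commute with the action, so a simplex whose orbit is degenerate is itself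
degenerate. -/
lemma orbitMk_mem_nonDegenerate_iff {n : ℕ} (s : (nerve X) _⦋n⦌) :
    orbitMk G s ∈ (orbitNerve G X).nonDegenerate n ↔ StrictMono s.obj := by
  rw [← PartialOrder.mem_nerve_nonDegenerate_iff_strictMono, ← not_iff_not,
    ← SSet.mem_degenerate_iff_notMem_nonDegenerate,
    ← SSet.mem_degenerate_iff_notMem_nonDegenerate]
  obtain _ | n := n
  · simp
  simp only [SSet.degenerate_eq_iUnion_range_σ, Set.mem_iUnion, Set.mem_range]
  constructor
  · rintro ⟨i, t, ht⟩
    obtain ⟨t, rfl⟩ := orbitMk_surjective G t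
    obtain ⟨g, hg⟩ := (orbitMk_eq_iff G _ _).1 ht.symm
    exact ⟨i, g • t, hg⟩
  · rintro ⟨i, t, rfl⟩
    exact ⟨i, orbitMk G t, rfl⟩

end OrbitNerve

/-! ### Nondegenerate simplices as finite chains -/

section NerveVertices

open Simplicial SSet

variable {X : Type u} [PartialOrder X]

lemma eq_of_nerveVertices_eq {n : ℕ} {s t : (nerve X) _⦋n⦌} (hs : StrictMono s.obj)
    (ht : StrictMono t.obj) (h : nerveVertices s = nerveVertices t) : s = t :=
  nerve.ext_of_isThin ((hs.range_inj ht).1 h)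

lemma isChain_nerveVertices {n : ℕ} (s : (nerve X) _⦋n⦌) :
    IsChain (· ≤ ·) (nerveVertices s) := by
  rintro _ ⟨i, rfl⟩ _ ⟨j, rfl⟩ -
  exact (le_total i j).imp (fun h => s.monotone h) fun h => s.monotone h

lemma nerveVertices_δ {n : ℕ} {s : (nerve X) _⦋n + 1⦌} (hs : StrictMono s.obj)
    (i : Fin (n + 2)) :
    nerveVertices ((nerve X).δ i s) = nerveVertices s \ {s.obj i} := by
  have h : ((nerve X).δ i s).obj = s.obj ∘ i.succAbove := funext fun j => nerve.δ_obj i s j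
  unfold nerveVertices
  rw [h, Set.range_comp, Fin.range_succAbove, Set.image_compl_eq_range_sdiff_image hs.injective,
    Set.image_singleton]

lemma strictMono_δ {n : ℕ} {s : (nerve X) _⦋n + 1⦌} (hs : StrictMono s.obj)
    (i : Fin (n + 2)) : StrictMono ((nerve X).δ i s).obj := by
  have h : ((nerve X).δ i s).obj = s.obj ∘ i.succAbove := funext fun j => nerve.δ_obj i s j
  rw [h]
  exact hs.comp (Fin.strictMono_succAbove i)

/-- A finite chain with `n + 1` elements is the set of vertices of a nondegenerate simplex. -/
lemma exists_nerveVertices_eq {ρ : X → ℕ} (hρ : StrictMono ρ) {c : Set X}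
    (hc : IsChain (· ≤ ·) c) {n : ℕ} (hn : c.ncard = n + 1) :
    ∃ s : (nerve X) _⦋n⦌, StrictMono s.obj ∧ nerveVertices s = c := by
  classical
  have hfin : c.Finite := Set.finite_of_ncard_ne_zero (by lia)
  have hlt {x y : X} (hx : x ∈ c) (hy : y ∈ c) (h : ρ x < ρ y) : x < y := by
    obtain h' | h' := hc.total hx hy
    · exact lt_of_le_of_ne h' (by rintro rfl; exact h.ne rfl)
    · exact absurd (hρ.monotone h') (by lia)
  have hinj : Set.InjOn ρ c := fun x hx y hy h => by
    obtain h' | h' := hc.total hx hy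
    · by_contra hne
      exact (hρ (lt_of_le_of_ne h' hne)).ne h
    · by_contra hne
      exact (hρ (lt_of_le_of_ne h' (Ne.symm hne))).ne h.symm
  -- The rank is injective on the chain, so listing its values in increasing order lists the chain.
  let F : Finset ℕ := hfin.toFinset.image ρ
  have hF : F.card = n + 1 := by
    rw [Finset.card_image_of_injOn (by simpa using hinj), ← hn, Set.ncard_eq_toFinset_card c hfin]
  have he (i) : ∃ x ∈ c, ρ x = F.orderEmbOfFin hF i := by
    obtain ⟨x, hx, h⟩ := Finset.mem_image.1 (F.orderEmbOfFin_mem hF i)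
    exact ⟨x, by simpa using hx, h⟩
  choose x hx hxρ using he
  have hmono : StrictMono x := fun i j hij => hlt (hx i) (hx j) (by
    rw [hxρ, hxρ]; exact (F.orderEmbOfFin hF).strictMono hij)
  refine ⟨hmono.monotone.functor, hmono, ?_⟩
  apply Set.Subset.antisymm
  · rintro _ ⟨i, rfl⟩
    exact hx i
  · intro y hy
    have : ρ y ∈ Set.range (F.orderEmbOfFin hF) := by
      rw [Finset.range_orderEmbOfFin]
      simpa [F] using ⟨y, hy, rfl⟩
    obtain ⟨i, hi⟩ := this
    exact ⟨i, hinj (hx i) hy ((hxρ i).trans hi)⟩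

end NerveVertices

/-! ### Matchings on orbits of chains -/

section OrbitToggle

open Simplicial SSet

/-- A rule which, up to the action of the stabilizer, assigns to every chain of a `G`-poset not
contained in `S` an element whose insertion or removal gives again such a chain with the same
assigned element. The third argument of `Tog` is a rank that makes this matching acyclic. -/
structure OrbitToggle (G : Type u) [Group G] {X : Type u} [PartialOrder X] [MulAction G X]
    (S : Set X) (α : Type*) [PartialOrder α] where
  /-- `Tog c x m` means that `x` is assigned to `c`, with rank `m`. -/
  Tog : Set X → X → α → Prop
  smul_tog (g : G) {c : Set X} {x : X} {m : α} : Tog c x m → Tog (g • c) (g • x) m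
  exists_tog {c : Set X} : IsChain (· ≤ ·) c → c.Nonempty → ¬ c ⊆ S → ∃ x m, Tog c x m
  unique {c : Set X} {x x' : X} {m m' : α} : IsChain (· ≤ ·) c → Tog c x m → Tog c x' m' →
    m = m' ∧ ∃ g : G, g • c = c ∧ g • x = x'
  tog_insert {c : Set X} {x : X} {m : α} : IsChain (· ≤ ·) c → ¬ c ⊆ S → x ∉ c → Tog c x m →
    IsChain (· ≤ ·) (insert x c) ∧ ∃ m', Tog (insert x c) x m'
  tog_erase {c : Set X} {x : X} {m : α} : IsChain (· ≤ ·) c → ¬ c ⊆ S → x ∈ c → Tog c x m →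
    ¬ c \ {x} ⊆ S ∧ ∃ m', Tog (c \ {x}) x m'
  lt {c : Set X} {x x' a : X} {m m' : α} : IsChain (· ≤ ·) c → ¬ c ⊆ S → x ∉ c → Tog c x m →
    a ∈ c → ¬ insert x c \ {a} ⊆ S → x' ∉ insert x c \ {a} →
    Tog (insert x c \ {a}) x' m' → m' < m

namespace OrbitToggle

variable {G : Type u} [Group G] {X Y : Type u} [PartialOrder X] [MulAction G X]
  [CovariantClass G X HSMul.hSMul LE.le] [PartialOrder Y] [MulAction G Y]
  [CovariantClass G Y HSMul.hSMul LE.le]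
  {S : Set X} {α : Type*} [PartialOrder α] (T : OrbitToggle G S α)

/-- The simplex `s` contains, as its `i`-th vertex, an element assigned to it. -/
structure IsUpper {n : ℕ} (s : (nerve X) _⦋n + 1⦌) (i : Fin (n + 2)) : Prop where
  strictMono : StrictMono s.obj
  not_subset : ¬ nerveVertices s ⊆ S
  exists_tog : ∃ m, T.Tog (nerveVertices s) (s.obj i) m

namespace IsUpper

variable {T} {n : ℕ} {s t : (nerve X) _⦋n + 1⦌} {i j : Fin (n + 2)}

omit [CovariantClass G X HSMul.hSMul LE.le] in
lemma not_subset_δ (h : T.IsUpper s i) : ¬ nerveVertices ((nerve X).δ i s) ⊆ S := by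
  obtain ⟨m, hm⟩ := h.exists_tog
  rw [nerveVertices_δ h.strictMono]
  exact (T.tog_erase (isChain_nerveVertices s) h.not_subset ⟨i, rfl⟩ hm).1

omit [CovariantClass G X HSMul.hSMul LE.le] in
lemma exists_tog_δ (h : T.IsUpper s i) :
    ∃ m, T.Tog (nerveVertices ((nerve X).δ i s)) (s.obj i) m := by
  obtain ⟨m, hm⟩ := h.exists_tog
  rw [nerveVertices_δ h.strictMono]
  exact (T.tog_erase (isChain_nerveVertices s) h.not_subset ⟨i, rfl⟩ hm).2

lemma smul (hS : ∀ (g : G) x, g • x ∈ S ↔ x ∈ S) (h : T.IsUpper s i) (g : G) :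
    T.IsUpper (g • s) i where
  strictMono := strictMono_smul G h.strictMono g
  not_subset h' := h.not_subset (by
    rintro _ ⟨a, rfl⟩
    exact (hS g _).1 (h' ⟨a, rfl⟩))
  exists_tog := by
    obtain ⟨m, hm⟩ := h.exists_tog
    refine ⟨m, ?_⟩
    rw [nerveVertices_smul]
    exact T.smul_tog g hm

/-- An element of `G` preserving the vertex set of a strict chain fixes every vertex, so the
ambiguity allowed by `unique` disappears inside the chain. -/
lemma index_eq (hs : T.IsUpper s i) (ht : T.IsUpper s j) : i = j := by
  obtain ⟨m, hm⟩ := hs.exists_tog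
  obtain ⟨m', hm'⟩ := ht.exists_tog
  obtain ⟨-, g, hg, hij⟩ := T.unique (isChain_nerveVertices s) hm hm'
  rw [← nerveVertices_smul] at hg
  have := eq_of_nerveVertices_eq (strictMono_smul G hs.strictMono g) hs.strictMono hg
  have h' : (g • s).obj i = s.obj j := hij
  rw [this] at h'
  exact hs.strictMono.injective h'

lemma orbitMk_δ_eq (hS : ∀ (g : G) x, g • x ∈ S ↔ x ∈ S) (hs : T.IsUpper s i)
    (ht : T.IsUpper t j) (h : orbitMk G s = orbitMk G t) :
    orbitMk G ((nerve X).δ i s) = orbitMk G ((nerve X).δ j t) := by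
  obtain ⟨g, rfl⟩ := (orbitMk_eq_iff G _ _).1 h
  obtain rfl := hs.index_eq (ht.smul hS g)
  exact orbitMk_smul G g ((nerve X).δ i t)

/-- After translation the two lower chains agree; `unique` moves one inserted element to the other
by an element stabilising that chain. -/
lemma orbitMk_eq_of_δ (hS : ∀ (g : G) x, g • x ∈ S ↔ x ∈ S) (hs : T.IsUpper s i)
    (ht : T.IsUpper t j)
    (h : orbitMk G ((nerve X).δ i s) = orbitMk G ((nerve X).δ j t)) :
    orbitMk G s = orbitMk G t := by
  obtain ⟨g, hg⟩ := (orbitMk_eq_iff G _ _).1 h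
  have ht' := ht.smul hS g
  rw [← δ_smul] at hg
  rw [← orbitMk_smul G g t]
  generalize g • t = t' at ht' hg
  obtain ⟨m, hm⟩ := hs.exists_tog_δ
  obtain ⟨m', hm'⟩ := ht'.exists_tog_δ
  rw [hg] at hm'
  obtain ⟨-, k, hk, hij⟩ := T.unique (isChain_nerveVertices _) hm hm'
  rw [eq_comm, orbitMk_eq_iff]
  refine ⟨k, eq_of_nerveVertices_eq (strictMono_smul G hs.strictMono k) ht'.strictMono ?_⟩
  have h1 : nerveVertices s = insert (s.obj i) (nerveVertices ((nerve X).δ i s)) := by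
    rw [nerveVertices_δ hs.strictMono]
    exact (Set.insert_sdiff_self_of_mem (Set.mem_range_self i)).symm
  have h2 : nerveVertices t' = insert (t'.obj j) (nerveVertices ((nerve X).δ j t')) := by
    rw [nerveVertices_δ ht'.strictMono]
    exact (Set.insert_sdiff_self_of_mem (Set.mem_range_self j)).symm
  rw [nerveVertices_smul, h1, h2, Set.smul_set_insert, hk, hij, hg]

/-- No orbit is both upper and lower: the stabilizer of a chain cannot carry an assigned element in
the chain to one outside it. -/
lemma orbitMk_ne {t : (nerve X) _⦋n + 2⦌} {j : Fin (n + 3)}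
    (hS : ∀ (g : G) x, g • x ∈ S ↔ x ∈ S) (hs : T.IsUpper s i) (ht : T.IsUpper t j) :
    orbitMk G s ≠ orbitMk G ((nerve X).δ j t) := by
  intro h
  obtain ⟨g, rfl⟩ := (orbitMk_eq_iff G _ _).1 h
  have ht' := ht.smul hS g
  obtain ⟨m, hm⟩ := hs.exists_tog
  obtain ⟨m', hm'⟩ := ht'.exists_tog_δ
  obtain ⟨-, k, hk, hij⟩ := T.unique (isChain_nerveVertices _) hm hm'
  have h1 : (g • t).obj j ∈ nerveVertices ((nerve X).δ j (g • t)) := by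
    rw [← hij]
    have : k • ((g • (nerve X).δ j t).obj i) ∈ k • nerveVertices (g • (nerve X).δ j t) :=
      Set.smul_mem_smul_set ⟨i, rfl⟩
    rwa [hk] at this
  rw [nerveVertices_δ ht'.strictMono] at h1
  exact h1.2 rfl

end IsUpper

end OrbitToggle

end OrbitToggle

/-! ### The pairing on the orbit space and its acyclicity -/

section OrbitToggle

open Simplicial SSet

namespace OrbitToggle

variable {G : Type u} [Group G] {X Y : Type u} [PartialOrder X] [MulAction G X]
  [CovariantClass G X HSMul.hSMul LE.le]

section UpperOrbit

variable {S : Set X} {α : Type*} [PartialOrder α] (T : OrbitToggle G S α)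

/-- The orbits of simplices containing an element assigned to them. -/
def UpperOrbit : Type u :=
  {q : Σ n : ℕ, (orbitNerve G X) _⦋n + 1⦌ // ∃ s i, T.IsUpper s i ∧ orbitMk G s = q.2}

namespace UpperOrbit

variable {T} (q : T.UpperOrbit)

/-- A simplex representing the orbit. -/
noncomputable def rep : (nerve X) _⦋q.1.1 + 1⦌ := q.2.choose

/-- The position in the representative of an element assigned to it. -/
noncomputable def index : Fin (q.1.1 + 2) := q.2.choose_spec.choose

lemma isUpper : T.IsUpper q.rep q.index := q.2.choose_spec.choose_spec.1

lemma orbitMk_rep : orbitMk G q.rep = q.1.2 := q.2.choose_spec.choose_spec.2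

/-- The rank of the lower simplex matched with an orbit. -/
noncomputable def rank : α := q.isUpper.exists_tog_δ.choose

lemma tog_rank :
    T.Tog (nerveVertices ((nerve X).δ q.index q.rep)) (q.rep.obj q.index) q.rank :=
  q.isUpper.exists_tog_δ.choose_spec

lemma δ_eq : (orbitNerve G X).δ q.index q.1.2 = orbitMk G ((nerve X).δ q.index q.rep) := by
  rw [← q.orbitMk_rep]
  rfl

/-- Distinct faces of a simplex could be identified in the orbit space. The invariant rank `ρ` takes
distinct values on the vertices, so the ranks of a face reveal which vertex is missing. -/
lemma eq_index_of_δ_eq {ρ : X → ℕ} (hρ : StrictMono ρ) (hρG : ∀ (g : G) x, ρ (g • x) = ρ x)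
    {i : Fin (q.1.1 + 2)}
    (hi : (orbitNerve G X).δ i q.1.2 = (orbitNerve G X).δ q.index q.1.2) : i = q.index := by
  rw [← q.orbitMk_rep, δ_orbitMk, δ_orbitMk, orbitMk_eq_iff] at hi
  obtain ⟨g, hg⟩ := hi
  have h1 (j) : ρ (q.rep.obj (q.index.succAbove j)) = ρ (q.rep.obj (i.succAbove j)) := by
    have h2 := congrArg (fun s : (nerve X) _⦋q.1.1⦌ => ρ (s.obj j)) hg
    exact (hρG g _).symm.trans h2
  have hinj : Function.Injective fun a => ρ (q.rep.obj a) :=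
    (hρ.comp q.isUpper.strictMono).injective
  exact Fin.succAbove_left_injective (funext fun j => (hinj (h1 j)).symm)

end UpperOrbit

end UpperOrbit

variable [PartialOrder Y] [MulAction G Y] [CovariantClass G Y HSMul.hSMul LE.le]

lemma mem_range_orbitNerveMap_iff (f : Y ↪o X) (hf : ∀ (g : G) y, f (g • y) = g • f y) {n : ℕ}
    (s : (nerve X) _⦋n⦌) :
    orbitMk G s ∈ (Subcomplex.range (orbitNerveMap G (f : Y →o X) hf)).obj (op ⦋n⦌) ↔
      nerveVertices s ⊆ Set.range f := by
  constructor
  · rintro ⟨q, hq⟩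
    obtain ⟨t, rfl⟩ := orbitMk_surjective G q
    obtain ⟨g, hg⟩ := (orbitMk_eq_iff G _ _).1 hq.symm
    rintro _ ⟨i, rfl⟩
    refine ⟨g • t.obj i, ?_⟩
    rw [hf, ← hg]
    rfl
  · intro h
    choose y hy using fun i => h ⟨i, rfl⟩
    have hmono : Monotone y := fun i j hij => by
      rw [← f.le_iff_le, hy, hy]
      exact s.monotone hij
    exact ⟨orbitMk G (n := op ⦋n⦌) hmono.functor,
      congrArg (orbitMk G) (nerve.ext_of_isThin (funext hy))⟩

omit [CovariantClass G X HSMul.hSMul LE.le] [CovariantClass G Y HSMul.hSMul LE.le] in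
lemma smul_mem_range_iff (f : Y ↪o X) (hf : ∀ (g : G) y, f (g • y) = g • f y) (g : G) (x : X) :
    g • x ∈ Set.range f ↔ x ∈ Set.range f := by
  constructor
  · rintro ⟨y, hy⟩
    exact ⟨g⁻¹ • y, by rw [hf, hy, inv_smul_smul]⟩
  · rintro ⟨y, rfl⟩
    exact ⟨g • y, hf g y⟩

lemma mono_orbitNerveMap (f : Y ↪o X) (hf : ∀ (g : G) y, f (g • y) = g • f y) :
    Mono (orbitNerveMap G (f : Y →o X) hf) := by
  rw [NatTrans.mono_iff_mono_app]
  intro n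
  rw [mono_iff_injective]
  intro a b hab
  obtain ⟨s, rfl⟩ := orbitMk_surjective G a
  obtain ⟨t, rfl⟩ := orbitMk_surjective G b
  obtain ⟨g, hg⟩ := (orbitMk_eq_iff G _ _).1 hab
  refine (orbitMk_eq_iff G _ _).2 ⟨g, nerve.ext_of_isThin (funext fun i => f.injective ?_)⟩
  have := congrArg (fun u : (nerve X).obj n => u.obj i) hg
  exact (hf g (t.obj i)).trans this

variable {f : Y ↪o X} (hf : ∀ (g : G) y, f (g • y) = g • f y)
  {α : Type*} [PartialOrder α] (T : OrbitToggle G (Set.range f) α)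
  {ρ : X → ℕ}

/-- The matching on the orbit space defined by an orbit toggle. -/
noncomputable def pairingCore (hρ : StrictMono ρ) :
    (Subcomplex.range (orbitNerveMap G (f : Y →o X) hf)).PairingCore where
  ι := T.UpperOrbit
  dim q := q.1.1
  simplex q := q.1.2
  index q := q.index
  nonDegenerate₁ q := by
    rw [← q.orbitMk_rep, orbitMk_mem_nonDegenerate_iff]
    exact q.isUpper.strictMono
  nonDegenerate₂ q := by
    rw [q.δ_eq, orbitMk_mem_nonDegenerate_iff]
    exact strictMono_δ q.isUpper.strictMono _
  notMem₁ q := by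
    rw [← q.orbitMk_rep, mem_range_orbitNerveMap_iff]
    exact q.isUpper.not_subset
  notMem₂ q := by
    rw [q.δ_eq, mem_range_orbitNerveMap_iff]
    exact q.isUpper.not_subset_δ
  injective_type₁' {q r} h := by
    obtain ⟨⟨n, q⟩, hq⟩ := q
    obtain ⟨⟨m, r⟩, hr⟩ := r
    obtain rfl : n = m := by simpa using S.dim_eq_of_mk_eq h
    obtain rfl := (S.ext_iff _ _).1 h
    rfl
  injective_type₂' {q r} h := by
    obtain ⟨⟨n, q⟩, hq⟩ := q
    obtain ⟨⟨m, r⟩, hr⟩ := r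
    obtain rfl : n = m := S.dim_eq_of_mk_eq h
    have h' := (S.ext_iff _ _).1 h
    let q' : T.UpperOrbit := ⟨⟨n, q⟩, hq⟩
    let r' : T.UpperOrbit := ⟨⟨n, r⟩, hr⟩
    have := q'.isUpper.orbitMk_eq_of_δ (smul_mem_range_iff f hf) r'.isUpper
      (q'.δ_eq.symm.trans (h'.trans r'.δ_eq))
    obtain rfl : q = r := q'.orbitMk_rep.symm.trans (this.trans r'.orbitMk_rep)
    rfl
  type₁_ne_type₂' q r h := by
    obtain ⟨⟨n, q⟩, hq⟩ := q
    obtain ⟨⟨m, r⟩, hr⟩ := r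
    obtain rfl : n + 1 = m := S.dim_eq_of_mk_eq h
    have h' := (S.ext_iff _ _).1 h
    exact (UpperOrbit.isUpper _).orbitMk_ne (smul_mem_range_iff f hf) (UpperOrbit.isUpper _)
      ((UpperOrbit.orbitMk_rep _).trans (h'.trans (UpperOrbit.δ_eq _)))
  surjective' x := by
    obtain ⟨n, q, hq, hq', rfl⟩ := x.mk_surjective
    obtain ⟨s, rfl⟩ := orbitMk_surjective G q
    rw [orbitMk_mem_nonDegenerate_iff] at hq
    rw [mem_range_orbitNerveMap_iff] at hq'
    obtain ⟨x, m, hm⟩ := T.exists_tog (isChain_nerveVertices s) ⟨_, 0, rfl⟩ hq'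
    by_cases hx : x ∈ nerveVertices s
    · obtain ⟨i, rfl⟩ := hx
      -- A single vertex cannot be its own assigned element: removing it leaves the empty chain,
      -- which lies in `S`, against `tog_erase`.
      obtain _ | n := n
      · refine absurd ?_ (T.tog_erase (isChain_nerveVertices s) hq' ⟨i, rfl⟩ hm).1
        rintro _ ⟨⟨j, rfl⟩, hj⟩
        obtain rfl : j = i := Subsingleton.elim (α := Fin 1) _ _
        exact absurd rfl hj
      · exact ⟨⟨⟨n, orbitMk G s⟩, s, i, ⟨hq, hq', m, hm⟩, rfl⟩, Or.inl rfl⟩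
    · obtain ⟨hc, m', hm'⟩ := T.tog_insert (isChain_nerveVertices s) hq' hx hm
      have hcard : (nerveVertices s).ncard = n + 1 := by
        rw [nerveVertices, ← Set.image_univ, Set.ncard_image_of_injective _ hq.injective,
          Set.ncard_univ, Nat.card_eq_fintype_card, Fintype.card_fin]
      obtain ⟨t, ht, htc⟩ := exists_nerveVertices_eq hρ hc (n := n + 1) (by
        rw [Set.ncard_insert_of_notMem hx (Set.finite_range _), hcard])
      obtain ⟨j, rfl⟩ : x ∈ nerveVertices t := htc ▸ Set.mem_insert _ _
      have hst : (nerve X).δ j t = s := by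
        refine eq_of_nerveVertices_eq (strictMono_δ ht j) hq ?_
        rw [nerveVertices_δ ht, htc, Set.insert_sdiff_self_of_notMem hx]
      have hup : T.IsUpper t j :=
        ⟨ht, fun h => hq' ((Set.subset_insert _ _).trans (htc ▸ h)), m', htc ▸ hm'⟩
      let r : T.UpperOrbit := ⟨⟨n, orbitMk G t⟩, t, j, hup, rfl⟩
      -- The chosen representative of `r` need not be `t`, so the lower faces are compared by
      -- `orbitMk_δ_eq`.
      refine ⟨r, Or.inr ?_⟩
      refine (S.ext_iff (X := orbitNerve G X) (orbitMk G s) _).2 ?_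
      rw [r.δ_eq, ← hst]
      exact hup.orbitMk_δ_eq (smul_mem_range_iff f hf) r.isUpper r.orbitMk_rep.symm

lemma isProper_pairingCore (hρ : StrictMono ρ) (hρG : ∀ (g : G) x, ρ (g • x) = ρ x) :
    (pairingCore hf T hρ).IsProper where
  isUniquelyCodimOneFace q :=
    (S.IsUniquelyCodimOneFace.iff _ _).2 ⟨UpperOrbit.index q, rfl, fun _ hi =>
      UpperOrbit.eq_index_of_δ_eq q hρ hρG hi⟩

/-- The rank function of the matching defined by an orbit toggle. -/
noncomputable def weakRankFunction (hρ : StrictMono ρ) :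
    (pairingCore hf T hρ).WeakRankFunction α where
  rank q := UpperOrbit.rank (T := T) q
  lt {q r} h hdim := by
    obtain ⟨⟨n, q⟩, hq⟩ := q
    obtain ⟨⟨m, r⟩, hr⟩ := r
    obtain rfl : n = m := hdim
    set q' : T.UpperOrbit := ⟨⟨n, q⟩, hq⟩
    set r' : T.UpperOrbit := ⟨⟨n, r⟩, hr⟩
    obtain ⟨φ, hφ, hφ'⟩ := SSet.N.le_iff_exists_mono.1 h.2.le
    obtain ⟨a, rfl⟩ := @SimplexCategory.eq_δ_of_mono n φ hφ
    have h1 : (orbitNerve G X).δ a r'.1.2 = (orbitNerve G X).δ q'.index q'.1.2 := hφ'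
    rw [q'.δ_eq, ← r'.orbitMk_rep, δ_orbitMk, eq_comm, orbitMk_eq_iff] at h1
    obtain ⟨g, hg⟩ := h1
    rw [← δ_smul] at hg
    have hS := smul_mem_range_iff f hf (G := G)
    have hup := r'.isUpper.smul hS g
    have htog := T.smul_tog g r'.tog_rank
    rw [← nerveVertices_smul, ← δ_smul, ← smul_obj, nerveVertices_δ hup.strictMono] at htog
    -- With equal indices, `q` and `r` would share their lower orbit and so coincide.
    have hne : (g • r'.rep).obj a ≠ (g • r'.rep).obj r'.index := fun h' => by
      have ha := hup.strictMono.injective h'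
      refine h.1 (Subtype.ext ?_)
      have h3 : orbitMk G ((nerve X).δ q'.index q'.rep) =
          orbitMk G ((nerve X).δ r'.index r'.rep) := by
        rw [← hg, ha]
        exact orbitMk_smul G g ((nerve X).δ r'.index r'.rep)
      have h4 := q'.isUpper.orbitMk_eq_of_δ hS r'.isUpper h3
      obtain rfl : q = r := q'.orbitMk_rep.symm.trans (h4.trans r'.orbitMk_rep)
      rfl
    -- With `c` the lower chain of `r` and `x` its assigned element, the lower chain of `q` is
    -- `insert x c \ {a}`, as required by `T.lt`.
    have hset : insert ((g • r'.rep).obj r'.index)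
        (nerveVertices (g • r'.rep) \ {(g • r'.rep).obj r'.index}) \ {(g • r'.rep).obj a} =
        nerveVertices ((nerve X).δ q'.index q'.rep) := by
      have hmem : (g • r'.rep).obj r'.index ∈ nerveVertices (g • r'.rep) := ⟨_, rfl⟩
      rw [Set.insert_sdiff_self_of_mem hmem, ← hg, nerveVertices_δ hup.strictMono]
    refine T.lt (x := (g • r'.rep).obj r'.index) (x' := q'.rep.obj q'.index)
      (a := (g • r'.rep).obj a) ?_ ?_ (fun h' => h'.2 rfl) htog ⟨⟨a, rfl⟩, hne⟩ ?_ ?_ ?_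
    · exact (isChain_nerveVertices _).mono Set.sdiff_subset
    · rw [← nerveVertices_δ hup.strictMono]
      exact hup.not_subset_δ
    · rw [hset]
      exact q'.isUpper.not_subset_δ
    · rw [hset, nerveVertices_δ q'.isUpper.strictMono]
      exact fun h' => h'.2 rfl
    · rw [hset]
      exact q'.tog_rank

include T in
/-- An orbit toggle makes the inclusion of orbit spaces an anodyne extension. -/
theorem anodyneExtensions_orbitNerveMap [WellFoundedLT α] (hρ : StrictMono ρ)
    (hρG : ∀ (g : G) x, ρ (g • x) = ρ x) :
    anodyneExtensions (orbitNerveMap G (f : Y →o X) hf) := by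
  have := isProper_pairingCore hf T hρ hρG
  have := (weakRankFunction hf T hρ).isRegular
  exact strongAnodyneExtensions_le_anodyneExtensions _
    ⟨mono_orbitNerveMap f hf, (pairingCore hf T hρ).pairing, inferInstance⟩

end OrbitToggle

end OrbitToggle

/-! ### Sylow subgroups of subgroups -/

section MaximalPSubgroups

variable {p : ℕ} {G : Type u} [Group G]

lemma conj_smul_eq_iff_mem_normalizer {k : G} {T : Subgroup G} :
    MulAut.conj k • T = T ↔ k ∈ Subgroup.normalizer (T : Set G) :=
  (Subgroup.mem_normalizer_iff_map_conj_eq).symm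

/-- In a finite `p`-group, normalizers grow. -/
lemma IsPGroup.exists_mem_normalizer_notMem [Fact p.Prime] {T Q : Subgroup G} [Finite Q]
    (hQ : IsPGroup p Q) (h : T < Q) :
    ∃ k ∈ Q, k ∉ T ∧ k ∈ Subgroup.normalizer (T : Set G) := by
  have := hQ.isNilpotent
  have h1 : T.subgroupOf Q < ⊤ :=
    lt_top_iff_ne_top.2 fun h' => h.not_ge (Subgroup.subgroupOf_eq_top.1 h')
  obtain ⟨k, hk, hk'⟩ := SetLike.exists_of_lt
    (Group.normalizerCondition_of_isNilpotent (T.subgroupOf Q) h1)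
  refine ⟨k, k.2, fun h' => hk' (Subgroup.mem_subgroupOf.2 h'), ?_⟩
  have h2 := Subgroup.mem_normalizer_iff.1 hk
  have hle : ∀ x ∈ T, (k : G) * x * (k : G)⁻¹ ∈ T := fun x hx => by
    simpa [Subgroup.mem_subgroupOf] using (h2 ⟨x, h.le hx⟩).1 (Subgroup.mem_subgroupOf.2 hx)
  have hle' : ∀ x, (k : G) * x * (k : G)⁻¹ ∈ T → x ∈ T := fun x hx => by
    have hxQ : x ∈ Q := by
      have := Q.mul_mem (Q.mul_mem (Q.inv_mem k.2) (h.le hx)) k.2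
      simpa [mul_assoc] using this
    simpa [Subgroup.mem_subgroupOf] using
      (h2 ⟨x, hxQ⟩).2 (Subgroup.mem_subgroupOf.2 (by simpa using hx))
  exact Subgroup.mem_normalizer_iff.2 fun x => ⟨hle x, hle' x⟩

/-- `R` is a maximal `p`-subgroup of `H`. -/
def IsMaxPSubgroup (p : ℕ) (H R : Subgroup G) : Prop :=
  Maximal (fun Q : Subgroup G => IsPGroup p Q ∧ Q ≤ H) R

namespace IsMaxPSubgroup

variable {H R : Subgroup G}

lemma smul (h : IsMaxPSubgroup p H R) (g : G) :
    IsMaxPSubgroup p (MulAut.conj g • H) (MulAut.conj g • R) := by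
  refine ⟨⟨h.prop.1.map _, Subgroup.map_mono h.prop.2⟩, fun Q hQ hle => ?_⟩
  rw [Subgroup.subset_pointwise_smul_iff]
  refine h.2 ⟨hQ.1.map _, Subgroup.subset_pointwise_smul_iff.1 hQ.2⟩ ?_
  rwa [← Subgroup.pointwise_smul_subset_iff]

/-- `R` normalises `T`, so `R ⊔ T` is a `p`-subgroup of `H` and maximality absorbs `T`. -/
lemma le_of_normal (h : IsMaxPSubgroup p H R) {T : Subgroup G} (hT : IsPGroup p T) (hTH : T ≤ H)
    (hn : H ≤ Subgroup.normalizer (T : Set G)) : T ≤ R :=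
  le_sup_right.trans (h.2 ⟨h.prop.1.to_sup_of_normal_right' hT (h.prop.2.trans hn),
    sup_le h.prop.2 hTH⟩ le_sup_left)

lemma mono {H' : Subgroup G} (h : IsMaxPSubgroup p H R) (hH : H' ≤ H) (hR : R ≤ H') :
    IsMaxPSubgroup p H' R :=
  ⟨⟨h.prop.1, hR⟩, fun _ hQ hle => h.2 ⟨hQ.1, hQ.2.trans hH⟩ hle⟩

/-- A larger `p`-subgroup of `H` would contain elements outside `R` normalising `R`, since
normalizers grow in `p`-groups. -/
lemma of_inf_normalizer [Finite G] [Fact p.Prime]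
    (h : IsMaxPSubgroup p (H ⊓ Subgroup.normalizer (R : Set G)) R) : IsMaxPSubgroup p H R := by
  refine ⟨⟨h.prop.1, h.prop.2.trans inf_le_left⟩, fun Q hQ hle => ?_⟩
  by_contra hlt
  obtain ⟨k, hkQ, hkR, hk⟩ := hQ.1.exists_mem_normalizer_notMem (lt_of_le_not_ge hle hlt)
  exact hkR (h.2 ⟨hQ.1.to_le inf_le_left, inf_le_inf_right _ hQ.2⟩
    (le_inf hle Subgroup.le_normalizer) ⟨hkQ, hk⟩)

lemma exists_smul_eq [Finite G] [Fact p.Prime] {R' : Subgroup G} (h : IsMaxPSubgroup p H R)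
    (h' : IsMaxPSubgroup p H R') : ∃ k ∈ H, MulAut.conj k • R = R' := by
  have key {R : Subgroup G} (h : IsMaxPSubgroup p H R) :
      ∃ P : Sylow p H, (P : Subgroup H).map H.subtype = R := by
    refine ⟨⟨R.subgroupOf H, h.prop.1.comap_subtype, fun {Q} hQ hle => ?_⟩,
      Subgroup.map_subgroupOf_eq_of_le h.prop.2⟩
    refine le_antisymm ?_ hle
    have h1 : Q.map H.subtype ≤ R := h.2 ⟨hQ.map _, Subgroup.map_subtype_le Q⟩ (by
      rw [← Subgroup.map_subgroupOf_eq_of_le h.prop.2]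
      exact Subgroup.map_mono hle)
    exact Subgroup.map_le_iff_le_comap.1 h1
  obtain ⟨P, rfl⟩ := key h
  obtain ⟨P', rfl⟩ := key h'
  obtain ⟨k, rfl⟩ := MulAction.exists_smul_eq H P P'
  refine ⟨k, k.2, ?_⟩
  change ((P : Subgroup H).map H.subtype).map (MulAut.conj (k : G)).toMonoidHom =
    ((P : Subgroup H).map (MulAut.conj k).toMonoidHom).map H.subtype
  rw [Subgroup.map_map, Subgroup.map_map]
  rfl

lemma exists_le [Finite G] {T : Subgroup G} (hT : IsPGroup p T) (hTH : T ≤ H) :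
    ∃ R, T ≤ R ∧ IsMaxPSubgroup p H R :=
  (Set.toFinite {Q : Subgroup G | IsPGroup p Q ∧ Q ≤ H}).exists_le_maximal ⟨hT, hTH⟩

end IsMaxPSubgroup

end MaximalPSubgroups

/-! ### The largest normalising member of a chain -/

section SylowToggle

namespace PSubgroupCollection

variable {p : ℕ} {G : Type u} [Group G] {D : PSubgroupCollection p G}

lemma smul_val (g : G) (x : D.carrier) : (g • x).1 = MulAut.conj g • x.1 := rfl

lemma smul_le_smul_iff {g : G} {x y : D.carrier} : g • x ≤ g • y ↔ x ≤ y :=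
  Subgroup.pointwise_smul_le_pointwise_smul_iff

lemma smul_lt_smul_iff {g : G} {x y : D.carrier} : g • x < g • y ↔ x < y := by
  simp only [lt_iff_le_not_ge, smul_le_smul_iff]

lemma smul_eq_self_iff {g : G} {x : D.carrier} :
    g • x = x ↔ g ∈ Subgroup.normalizer (x.1 : Set G) :=
  Subtype.ext_iff.trans conj_smul_eq_iff_mem_normalizer

lemma smul_eq_self_of_mem {g : G} {x : D.carrier} (h : g ∈ x.1) : g • x = x :=
  smul_eq_self_iff.2 (Subgroup.le_normalizer h)

lemma conj_mem_smul {g k : G} {x : D.carrier} (h : k ∈ (g • x).1) : g⁻¹ * k * g ∈ x.1 := by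
  have := Subgroup.mem_pointwise_smul_iff_inv_smul_mem.1 h
  rw [← map_inv] at this
  simpa using this

/-- The chain `c` is normalised, below its element `Q`, by `Q`. -/
def NormalizesBelow (c : Set D.carrier) (Q : D.carrier) : Prop :=
  ∀ x ∈ c, x ≤ Q → ∀ k ∈ Q.1, k • x = x

/-- `T` is the largest element of the chain `c` normalising all smaller elements. -/
structure IsTopNormalizing (c : Set D.carrier) (T : D.carrier) : Prop where
  mem : T ∈ c
  normalizesBelow : NormalizesBelow c T
  not_normalizesBelow : ∀ y ∈ c, T < y → ¬ NormalizesBelow c y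

/-- The elements of `G` normalising the elements of `c` up to `T` and contained in the others. -/
def stabilizerAt (c : Set D.carrier) (T : D.carrier) : Subgroup G :=
  (⨅ x ∈ {x | x ∈ c ∧ x ≤ T}, MulAction.stabilizer G x) ⊓ ⨅ y ∈ {y | y ∈ c ∧ T < y}, y.1

lemma mem_stabilizerAt {c : Set D.carrier} {T : D.carrier} {k : G} : k ∈ stabilizerAt c T ↔
    (∀ x ∈ c, x ≤ T → k • x = x) ∧ ∀ y ∈ c, T < y → k ∈ y.1 := by
  simp [stabilizerAt, Subgroup.mem_iInf]

lemma NormalizesBelow.smul {c : Set D.carrier} {Q : D.carrier} (h : NormalizesBelow c Q) (g : G) :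
    NormalizesBelow (g • c) (g • Q) := by
  rintro _ ⟨x, hx, rfl⟩ hxQ k hk
  have := h x hx (smul_le_smul_iff.1 hxQ) _ (conj_mem_smul hk)
  rwa [mul_smul, mul_smul, inv_smul_eq_iff] at this

lemma IsTopNormalizing.smul {c : Set D.carrier} {T : D.carrier} (h : IsTopNormalizing c T) (g : G) :
    IsTopNormalizing (g • c) (g • T) where
  mem := Set.smul_mem_smul_set h.mem
  normalizesBelow := h.normalizesBelow.smul g
  not_normalizesBelow := by
    rintro _ ⟨y, hy, rfl⟩ hlt hy'
    refine h.not_normalizesBelow y hy (smul_lt_smul_iff.1 hlt) ?_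
    simpa using hy'.smul g⁻¹

lemma smul_stabilizerAt (g : G) (c : Set D.carrier) (T : D.carrier) :
    MulAut.conj g • stabilizerAt c T = stabilizerAt (g • c) (g • T) := by
  have key (g : G) (c : Set D.carrier) (T : D.carrier) :
      MulAut.conj g • stabilizerAt c T ≤ stabilizerAt (g • c) (g • T) := by
    rintro _ ⟨k, hk, rfl⟩
    obtain ⟨h1, h2⟩ := mem_stabilizerAt.1 hk
    refine mem_stabilizerAt.2 ⟨?_, ?_⟩
    · rintro _ ⟨x, hx, rfl⟩ hxT
      change (g * k * g⁻¹) • g • x = g • x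
      rw [mul_smul, inv_smul_smul, mul_smul, h1 x hx (smul_le_smul_iff.1 hxT)]
    · rintro _ ⟨y, hy, rfl⟩ hTy
      exact Subgroup.smul_mem_pointwise_smul k (MulAut.conj g) y.1 (h2 y hy (smul_lt_smul_iff.1 hTy))
  refine le_antisymm (key g c T) ?_
  rw [Subgroup.subset_pointwise_smul_iff, ← map_inv]
  simpa using key g⁻¹ (g • c) (g • T)

lemma IsTopNormalizing.eq {c : Set D.carrier} {T T' : D.carrier} (hc : IsChain (· ≤ ·) c)
    (h : IsTopNormalizing c T) (h' : IsTopNormalizing c T') : T = T' := by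
  obtain hle | hle := hc.total h.mem h'.mem
  · exact hle.eq_of_not_lt fun hlt => h.not_normalizesBelow _ h'.mem hlt h'.normalizesBelow
  · exact (hle.eq_of_not_lt fun hlt =>
      h'.not_normalizesBelow _ h.mem hlt h.normalizesBelow).symm

lemma NormalizesBelow.le_stabilizerAt {c : Set D.carrier} {T : D.carrier}
    (h : NormalizesBelow c T) : T.1 ≤ stabilizerAt c T := fun k hk =>
  mem_stabilizerAt.2 ⟨fun x hx hxT => h x hx hxT k hk, fun _ _ hTy => hTy.le hk⟩

/-- `T` is a normal `p`-subgroup of `stabilizerAt c T`. -/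
lemma IsTopNormalizing.le_of_isMaxPSubgroup {c : Set D.carrier} {T : D.carrier}
    (h : IsTopNormalizing c T) {R : D.carrier} (hR : IsMaxPSubgroup p (stabilizerAt c T) R.1) :
    T ≤ R :=
  hR.le_of_normal (D.isPGroup _ T.2) h.normalizesBelow.le_stabilizerAt fun _ hk =>
    smul_eq_self_iff.1 ((mem_stabilizerAt.1 hk).1 T h.mem le_rfl)

/-- `R` normalises the members up to `T` and lies in the later ones, so it normalises everything
below it. A member above `R` is above `T` and already failed to do so in `c`. -/
lemma IsTopNormalizing.insert {c : Set D.carrier} {T R : D.carrier} (hc : IsChain (· ≤ ·) c)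
    (h : IsTopNormalizing c T) (hR : IsMaxPSubgroup p (stabilizerAt c T) R.1) :
    IsTopNormalizing (insert R c) R := by
  have hTR := h.le_of_isMaxPSubgroup hR
  have hgood : NormalizesBelow (Insert.insert R c) R := by
    rintro x (rfl | hx) hxR k hk
    · exact smul_eq_self_of_mem hk
    · obtain hxT | hTx := hc.total hx h.mem
      · exact (mem_stabilizerAt.1 (hR.prop.2 hk)).1 x hx hxT
      · obtain rfl | hTx := hTx.eq_or_lt
        · exact (mem_stabilizerAt.1 (hR.prop.2 hk)).1 _ hx le_rfl
        · exact smul_eq_self_of_mem ((mem_stabilizerAt.1 (hR.prop.2 hk)).2 x hx hTx)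
  refine ⟨Set.mem_insert _ _, hgood, ?_⟩
  rintro y (rfl | hy) hRy hy'
  · exact hRy.false
  · exact h.not_normalizesBelow y hy (hTR.trans_lt hRy) fun x hx => hy' x (.inr hx)

end PSubgroupCollection

end SylowToggle

/-! ### Toggling a Sylow subgroup of the chain stabilizer -/

section SylowToggle

namespace PSubgroupCollection

variable {p : ℕ} {G : Type u} [Group G] {D : PSubgroupCollection p G}

/-- The elements of `G` normalising the elements of `c` below `T` and contained in those
above `T`. -/
def strictStabilizerAt (c : Set D.carrier) (T : D.carrier) : Subgroup G :=
  (⨅ x ∈ {x | x ∈ c ∧ x < T}, MulAction.stabilizer G x) ⊓ ⨅ y ∈ {y | y ∈ c ∧ T < y}, y.1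

lemma mem_strictStabilizerAt {c : Set D.carrier} {T : D.carrier} {k : G} :
    k ∈ strictStabilizerAt c T ↔
      (∀ x ∈ c, x < T → k • x = x) ∧ ∀ y ∈ c, T < y → k ∈ y.1 := by
  simp [strictStabilizerAt, Subgroup.mem_iInf]

/-- Inside the strict stabilizer, the normalizer of `T` lies in `stabilizerAt c T`, so
`of_inf_normalizer` applies. -/
lemma isMaxPSubgroup_strictStabilizerAt [Finite G] [Fact p.Prime] {c : Set D.carrier}
    {T : D.carrier} (hT : IsMaxPSubgroup p (stabilizerAt c T) T.1) :
    IsMaxPSubgroup p (strictStabilizerAt c T) T.1 := by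
  refine IsMaxPSubgroup.of_inf_normalizer (hT.mono ?_ ?_)
  · rintro k ⟨hk, hk'⟩
    obtain ⟨h1, h2⟩ := mem_strictStabilizerAt.1 hk
    refine mem_stabilizerAt.2 ⟨fun x hx hxT => ?_, h2⟩
    obtain rfl | hlt := hxT.eq_or_lt
    · exact smul_eq_self_iff.2 hk'
    · exact h1 x hx hlt
  · refine le_inf (fun k hk => ?_) Subgroup.le_normalizer
    obtain ⟨h1, h2⟩ := mem_stabilizerAt.1 (hT.prop.2 hk)
    exact mem_strictStabilizerAt.2 ⟨fun x hx hxT => h1 x hx hxT.le, h2⟩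

/-- Otherwise the smallest member above `T` would be a `p`-subgroup of the strict stabilizer
properly containing the maximal one `T`. -/
lemma exists_smul_ne_of_isMaxPSubgroup [Finite G] [Fact p.Prime] {c : Set D.carrier}
    {T : D.carrier} (hc : IsChain (· ≤ ·) c) (hT : IsMaxPSubgroup p (stabilizerAt c T) T.1)
    {y : D.carrier} (hy : y ∈ c) (hTy : T < y) : ∃ x ∈ c, x < T ∧ ∃ k ∈ y.1, k • x ≠ x := by
  by_contra! h
  obtain ⟨z, hzy, hz⟩ := (Set.toFinite {z | z ∈ c ∧ T < z}).exists_le_minimal ⟨hy, hTy⟩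
  refine hz.prop.2.not_ge ((isMaxPSubgroup_strictStabilizerAt hT).2
    ⟨D.isPGroup _ z.2, fun k hk => mem_strictStabilizerAt.2 ⟨fun x hx hxT => ?_, ?_⟩⟩ hz.prop.2.le)
  · exact h x hx hxT k (hzy hk)
  · intro w hw hTw
    obtain hle | hle := hc.total hz.prop.1 hw
    · exact hle hk
    · exact hz.2 ⟨hw, hTw⟩ hle hk

/-- `R` is a maximal `p`-subgroup of the group attached to the largest normalising element
of `c`, and `m` measures the size of the latter. -/
def SylowTog (c : Set D.carrier) (R : D.carrier) (m : ℕ) : Prop :=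
  ∃ T, IsTopNormalizing c T ∧ IsMaxPSubgroup p (stabilizerAt c T) R.1 ∧
    m = Nat.card G - Nat.card T.1

lemma exists_isTopNormalizing [Finite G] {c : Set D.carrier}
    (hne : c.Nonempty) : ∃ T, IsTopNormalizing c T := by
  obtain ⟨a, ha⟩ := (Set.toFinite c).exists_minimal hne
  have ha' : NormalizesBelow c a := fun x hx hxa k hk => by
    rw [hxa.antisymm (ha.2 hx hxa)]
    exact smul_eq_self_of_mem hk
  obtain ⟨T, -, hT⟩ := (Set.toFinite {T | T ∈ c ∧ NormalizesBelow c T}).exists_le_maximal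
    ⟨ha.prop, ha'⟩
  exact ⟨T, hT.prop.1, hT.prop.2, fun y hy hTy hy' => hTy.not_ge (hT.2 ⟨hy, hy'⟩ hTy.le)⟩

lemma card_lt_card [Finite G] {P Q : Subgroup G} (h : P < Q) : Nat.card P < Nat.card Q :=
  Set.ncard_lt_ncard h

lemma IsTopNormalizing.eq_of_mem {c : Set D.carrier} {T R : D.carrier} (hc : IsChain (· ≤ ·) c)
    (h : IsTopNormalizing c T) (hR : IsMaxPSubgroup p (stabilizerAt c T) R.1) (hRc : R ∈ c) :
    R = T := by
  have := h.insert hc hR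
  rw [Set.insert_eq_of_mem hRc] at this
  exact this.eq hc h

lemma SylowTog.insert {c : Set D.carrier} {R : D.carrier} {m : ℕ} (hc : IsChain (· ≤ ·) c)
    (hRc : R ∉ c) (h : SylowTog c R m) :
    IsChain (· ≤ ·) (insert R c) ∧ ∃ m', SylowTog (insert R c) R m' := by
  obtain ⟨T, hT, hR, -⟩ := h
  have hTR := hT.le_of_isMaxPSubgroup hR
  have hle {y} (hy : y ∈ c) (h : T < y) : R ≤ y := fun k hk =>
    (mem_stabilizerAt.1 (hR.prop.2 hk)).2 y hy h
  refine ⟨hc.insert fun x hx _ => ?_, _, R, hT.insert hc hR, hR.mono (fun k hk => ?_)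
    (hT.insert hc hR).normalizesBelow.le_stabilizerAt, rfl⟩
  · obtain hxT | hTx := hc.total hx hT.mem
    · exact .inr (hxT.trans hTR)
    · obtain rfl | hTx := hTx.eq_or_lt
      · exact .inr hTR
      · exact .inl (hle hx hTx)
  · obtain ⟨h1, h2⟩ := mem_stabilizerAt.1 hk
    exact mem_stabilizerAt.2 ⟨fun x hx hxT => h1 x (.inr hx) (hxT.trans hTR), fun y hy hTy =>
      h2 y (.inr hy) ((hle hy hTy).lt_of_ne (by rintro rfl; exact hRc hy))⟩

/-- Here `R` is the largest normalising member. It is not the bottom of `c`: by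
`exists_smul_ne_of_isMaxPSubgroup` nothing could lie above it, so `c = {R}` with `R` Sylow in `G`.
Its predecessor becomes the largest normalising member, because each member above `R` moves
something strictly below `R`. -/
lemma SylowTog.erase [Finite G] [Fact p.Prime]
    {c : Set D.carrier} {R : D.carrier} {m : ℕ} (hc : IsChain (· ≤ ·) c)
    (hcS : ¬ c ⊆ {x | IsMaxPSubgroup p ⊤ x.1}) (hRc : R ∈ c) (h : SylowTog c R m) :
    ¬ c \ {R} ⊆ {x | IsMaxPSubgroup p ⊤ x.1} ∧ ∃ m', SylowTog (c \ {R}) R m' := by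
  obtain ⟨T, hT, hR, -⟩ := h
  obtain rfl := hT.eq_of_mem hc hR hRc
  have hne : {x | x ∈ c ∧ x < R}.Nonempty := by
    by_contra! h0
    have h1 : c = {R} := by
      refine Set.Subset.antisymm (fun y hy => ?_) (by simpa using hRc)
      by_contra hyR
      obtain hlt | hlt := (hc.total hy hRc)
      · exact (h0 ▸ (⟨hy, hlt.lt_of_ne hyR⟩ : y ∈ {x | x ∈ c ∧ x < R}) : y ∈ (∅ : Set _))
      · obtain ⟨x, hx, hxR, -⟩ :=
          exists_smul_ne_of_isMaxPSubgroup hc hR hy (hlt.lt_of_ne (Ne.symm hyR))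
        exact (h0 ▸ (⟨hx, hxR⟩ : x ∈ {x | x ∈ c ∧ x < R}) : x ∈ (∅ : Set _))
    apply hcS
    rintro x hx
    obtain rfl : x = R := by rw [h1] at hx; exact hx
    have h2 : strictStabilizerAt c x = ⊤ := eq_top_iff.2 fun k _ => by
      refine mem_strictStabilizerAt.2 ⟨fun y hy hyx => ?_, fun y hy hxy => ?_⟩
      all_goals rw [h1] at hy; obtain rfl := hy
      · exact hyx.false.elim
      · exact hxy.false.elim
    exact h2 ▸ isMaxPSubgroup_strictStabilizerAt hR
  obtain ⟨T, hT'⟩ := (Set.toFinite {x | x ∈ c ∧ x < R}).exists_maximal hne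
  have hlt {x} (hx : x ∈ c) (h : T < x) (hxR : x ≠ R) : R < x := by
    obtain hle | hle := hc.total hx hRc
    · exact absurd h (fun h => h.not_ge (hT'.2 ⟨hx, hle.lt_of_ne hxR⟩ h.le))
    · exact hle.lt_of_ne (Ne.symm hxR)
  have htop : IsTopNormalizing (c \ {R}) T := by
    refine ⟨⟨hT'.prop.1, hT'.prop.2.ne⟩, fun x hx hxT k hk => ?_, fun y hy hTy hy' => ?_⟩
    · exact hT.normalizesBelow x hx.1 (hxT.trans hT'.prop.2.le) k (hT'.prop.2.le hk)
    · obtain ⟨x, hx, hxR, k, hk, hkx⟩ :=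
        exists_smul_ne_of_isMaxPSubgroup hc hR hy.1 (hlt hy.1 hTy hy.2)
      exact hkx (hy' x ⟨hx, hxR.ne⟩ (hxR.le.trans (hlt hy.1 hTy hy.2).le) k hk)
  refine ⟨fun hS => hT'.prop.2.not_ge ?_, _, T, htop, ?_, rfl⟩
  · exact (hS htop.mem).2 ⟨D.isPGroup _ R.2, le_top⟩ hT'.prop.2.le
  · refine (isMaxPSubgroup_strictStabilizerAt hR).mono (fun k hk => ?_) fun k hk => ?_
    · obtain ⟨h1, h2⟩ := mem_stabilizerAt.1 hk
      refine mem_strictStabilizerAt.2 ⟨fun x hx hxR => h1 x ⟨hx, hxR.ne⟩ ?_, fun y hy hRy =>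
        h2 y ⟨hy, hRy.ne'⟩ (hT'.prop.2.trans hRy)⟩
      obtain hle | hle := hc.total hx hT'.prop.1
      · exact hle
      · exact hT'.2 ⟨hx, hxR⟩ hle
    · exact mem_stabilizerAt.2 ⟨fun x hx hxT =>
        hT.normalizesBelow x hx.1 (hxT.trans hT'.prop.2.le) k hk, fun y hy hTy =>
        (hlt hy.1 hTy hy.2).le hk⟩

/-- The matching of the chains in the poset `D` which do not consist of Sylow subgroups. -/
def sylowToggle [Finite G] [Fact p.Prime] (D : PSubgroupCollection p G)
    (hD : ∀ P ∈ D.carrier, ∀ Q : Subgroup G, IsPGroup p Q → P ≤ Q → Q ∈ D.carrier) :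
    OrbitToggle G {x : D.carrier | IsMaxPSubgroup p ⊤ x.1} ℕ where
  Tog := SylowTog
  smul_tog := by
    rintro g c x _ ⟨T, hT, hR, rfl⟩
    refine ⟨g • T, hT.smul g, ?_, ?_⟩
    · rw [← smul_stabilizerAt]
      exact hR.smul g
    · congr 1
      exact Nat.card_congr (Subgroup.equivSMul (MulAut.conj g) T.1).toEquiv
  exists_tog _ hne _ := by
    obtain ⟨T, hT⟩ := exists_isTopNormalizing hne
    obtain ⟨R, hTR, hR⟩ :=
      IsMaxPSubgroup.exists_le (D.isPGroup _ T.2) hT.normalizesBelow.le_stabilizerAt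
    exact ⟨⟨R, hD _ T.2 R hR.prop.1 hTR⟩, _, T, hT, hR, rfl⟩
  unique := by
    rintro c x x' _ _ hc ⟨T, hT, hR, rfl⟩ ⟨T', hT', hR', rfl⟩
    obtain rfl := hT.eq hc hT'
    refine ⟨rfl, ?_⟩
    -- Sylow conjugacy within a group that fixes every member of `c`.
    obtain ⟨k, hk, hkx⟩ := hR.exists_smul_eq hR'
    obtain ⟨h1, h2⟩ := mem_stabilizerAt.1 hk
    have hkc (x) (hx : x ∈ c) : k • x = x := by
      obtain hle | hle := hc.total hx hT.mem
      · exact h1 x hx hle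
      · obtain rfl | hlt := hle.eq_or_lt
        · exact h1 _ hx le_rfl
        · exact smul_eq_self_of_mem (h2 x hx hlt)
    exact ⟨k, (Set.image_congr hkc).trans (Set.image_id' c), Subtype.ext hkx⟩
  tog_insert hc _ hx h := h.insert hc hx
  tog_erase hc hcS hx h := h.erase hc hcS hx
  lt := by
    rintro c x x' a _ _ hc - hx ⟨T, hT, hR, rfl⟩ ha - - ⟨T', hT', -, rfl⟩
    have hTx : T < x := (hT.le_of_isMaxPSubgroup hR).lt_of_ne (by rintro rfl; exact hx hT.mem)
    have hc' : IsChain (· ≤ ·) (insert x c) := (SylowTog.insert hc hx ⟨T, hT, hR, rfl⟩).1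
    have hx' : x ∈ insert x c \ {a} := ⟨.inl rfl, by rintro rfl; exact hx ha⟩
    -- Removing `a` does not stop `x` from normalising what is below it, so the new largest
    -- normalising member is at least `x > T` and the rank drops.
    have hle : x ≤ T' := by
      by_contra hnot
      refine hT'.not_normalizesBelow x hx' ?_ fun y hy =>
        (hT.insert hc hR).normalizesBelow y hy.1
      exact ((hc'.total hx'.1 hT'.mem.1).resolve_left hnot).lt_of_not_ge hnot
    have h1 := card_lt_card (show T.1 < T'.1 from hTx.trans_le hle)
    have h2 : Nat.card T'.1 ≤ Nat.card G := Subgroup.card_le_card_group T'.1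
    lia

end PSubgroupCollection

end SylowToggle

/-! ### The subgroup `O_p(N_G(P))` -/

section RadicalCore

variable {p : ℕ} {G : Type u} [Group G]

instance pCore_normal : (pCore p G).Normal :=
  Subgroup.sSup_normal _ fun _ h => h.1

/-- Every normal `p`-subgroup lies in a fixed Sylow subgroup, hence so does their supremum. -/
lemma isPGroup_pCore [Finite G] : IsPGroup p (pCore p G) := by
  obtain ⟨R, -, hR⟩ := IsMaxPSubgroup.exists_le (H := (⊤ : Subgroup G))
    (IsPGroup.of_bot (p := p)) bot_le
  refine hR.prop.1.to_le (sSup_le fun K hK => hR.le_of_normal hK.2 le_top ?_)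
  have := hK.1
  exact (Subgroup.normalizer_eq_top K).ge

variable (p) in
/-- The largest normal `p`-subgroup of the normalizer of `P`. -/
def normalizerPCore (P : Subgroup G) : Subgroup G :=
  (pCore p (Subgroup.normalizer (P : Set G))).map (Subgroup.normalizer (P : Set G)).subtype

lemma isPGroup_normalizerPCore [Finite G] (P : Subgroup G) : IsPGroup p (normalizerPCore p P) :=
  isPGroup_pCore.map _

lemma normalizerPCore_le_normalizer (P : Subgroup G) :
    normalizerPCore p P ≤ Subgroup.normalizer (P : Set G) :=
  Subgroup.map_subtype_le _

lemma normalizer_le_normalizer_normalizerPCore (P : Subgroup G) :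
    Subgroup.normalizer (P : Set G) ≤ Subgroup.normalizer (normalizerPCore p P : Set G) := by
  rw [← Subgroup.normal_subgroupOf_iff_le_normalizer (normalizerPCore_le_normalizer P)]
  have h : (normalizerPCore p P).subgroupOf (Subgroup.normalizer (P : Set G)) = pCore p _ :=
    Subgroup.comap_map_eq_self_of_injective (Subgroup.subtype_injective _) _
  rw [h]
  infer_instance

lemma le_normalizerPCore {P L : Subgroup G} (hL : IsPGroup p L)
    (hLP : L ≤ Subgroup.normalizer (P : Set G))
    (hPL : Subgroup.normalizer (P : Set G) ≤ Subgroup.normalizer (L : Set G)) :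
    L ≤ normalizerPCore p P := by
  rw [← Subgroup.map_subgroupOf_eq_of_le hLP]
  exact Subgroup.map_mono (le_sSup
    ⟨(Subgroup.normal_subgroupOf_iff_le_normalizer hLP).2 hPL, hL.comap_subtype⟩)

lemma le_normalizerPCore_self {P : Subgroup G} (hP : IsPGroup p P) : P ≤ normalizerPCore p P :=
  le_normalizerPCore hP Subgroup.le_normalizer le_rfl

lemma normalizer_conj_smul (g : G) (P : Subgroup G) :
    Subgroup.normalizer ((MulAut.conj g • P : Subgroup G) : Set G) =
      MulAut.conj g • Subgroup.normalizer (P : Set G) :=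
  (Subgroup.map_equiv_normalizer_eq P (MulAut.conj g)).symm

lemma normalizerPCore_conj_smul [Finite G] (g : G) (P : Subgroup G) :
    normalizerPCore p (MulAut.conj g • P) = MulAut.conj g • normalizerPCore p P := by
  have key (g : G) (P : Subgroup G) :
      MulAut.conj g • normalizerPCore p P ≤ normalizerPCore p (MulAut.conj g • P) := by
    refine le_normalizerPCore ((isPGroup_normalizerPCore P).map _) ?_ ?_
    · rw [normalizer_conj_smul]
      exact Subgroup.map_mono (normalizerPCore_le_normalizer P)
    · rw [normalizer_conj_smul, normalizer_conj_smul]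
      exact Subgroup.map_mono (normalizer_le_normalizer_normalizerPCore P)
  refine le_antisymm ?_ (key g P)
  rw [Subgroup.subset_pointwise_smul_iff, ← map_inv]
  simpa using key g⁻¹ (MulAut.conj g • P)

lemma lt_normalizerPCore_of_not_isPRadicalSubgroup {P : Subgroup G} (hP : IsPGroup p P)
    (h : ¬ IsPRadicalSubgroup p P) : P < normalizerPCore p P :=
  (le_normalizerPCore_self hP).lt_of_ne fun h' => h ⟨hP, h'.symm⟩

end RadicalCore

/-! ### Toggling at a non-radical member -/

section RadicalToggle

namespace PSubgroupCollection

variable {p : ℕ} {G : Type u} [Group G] {C D : PSubgroupCollection p G}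

/-- `R` is the intersection with the normalizer of `P` of the smallest element of the chain `c`
not normalising `P`. -/
def IsLowerToggle (c : Set D.carrier) (P R : D.carrier) : Prop :=
  ∃ Q, IsLeast {x | x ∈ c ∧ ¬ x.1 ≤ Subgroup.normalizer (P.1 : Set G)} Q ∧
    R.1 = Q.1 ⊓ Subgroup.normalizer (P.1 : Set G)

/-- The chain `c` normalises `P`, and `R` is the product with `O_p(N_G(P))` of the largest element
of `c` not containing this group. -/
def IsUpperToggle (c : Set D.carrier) (P R : D.carrier) : Prop :=
  (∀ x ∈ c, x.1 ≤ Subgroup.normalizer (P.1 : Set G)) ∧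
    ∃ Q, IsGreatest {x | x ∈ c ∧ ¬ normalizerPCore p P.1 ≤ x.1} Q ∧
      R.1 = Q.1 ⊔ normalizerPCore p P.1

variable (C) in
/-- The element `R` and the rank assigned to the chain `c` by means of its smallest element
not in `C`. -/
def RadicalTog (c : Set D.carrier) (R : D.carrier) (m : ℕ ×ₗ ℕ) : Prop :=
  ∃ P, IsLeast {x | x ∈ c ∧ x.1 ∉ C.carrier} P ∧
    ((IsLowerToggle c P R ∧
        m = toLex (Nat.card G - Nat.card P.1, 2 * Nat.card G + 1 - Nat.card R.1)) ∨
      (IsUpperToggle c P R ∧ m = toLex (Nat.card G - Nat.card P.1, Nat.card R.1)))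

lemma smul_val_mem_iff (g : G) (x : D.carrier) : (g • x).1 ∈ C.carrier ↔ x.1 ∈ C.carrier := by
  refine ⟨fun h => ?_, C.conj_mem g x.1⟩
  have := C.conj_mem g⁻¹ _ h
  rwa [← smul_val, inv_smul_smul] at this

lemma isLeast_smul {c : Set D.carrier} {φ ψ : D.carrier → Prop} {Q : D.carrier} (g : G)
    (hφ : ∀ x, ψ (g • x) ↔ φ x) (h : IsLeast {x | x ∈ c ∧ φ x} Q) :
    IsLeast {x | x ∈ g • c ∧ ψ x} (g • Q) := by
  refine ⟨⟨Set.smul_mem_smul_set h.1.1, (hφ Q).2 h.1.2⟩, ?_⟩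
  rintro _ ⟨⟨x, hx, rfl⟩, hx'⟩
  exact smul_le_smul_iff.2 (h.2 ⟨hx, (hφ x).1 hx'⟩)

lemma isGreatest_smul {c : Set D.carrier} {φ ψ : D.carrier → Prop} {Q : D.carrier} (g : G)
    (hφ : ∀ x, ψ (g • x) ↔ φ x) (h : IsGreatest {x | x ∈ c ∧ φ x} Q) :
    IsGreatest {x | x ∈ g • c ∧ ψ x} (g • Q) := by
  refine ⟨⟨Set.smul_mem_smul_set h.1.1, (hφ Q).2 h.1.2⟩, ?_⟩
  rintro _ ⟨⟨x, hx, rfl⟩, hx'⟩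
  exact smul_le_smul_iff.2 (h.2 ⟨hx, (hφ x).1 hx'⟩)

lemma val_smul_le_normalizer_iff (g : G) (x P : D.carrier) :
    (g • x).1 ≤ Subgroup.normalizer ((g • P).1 : Set G) ↔
      x.1 ≤ Subgroup.normalizer (P.1 : Set G) := by
  rw [smul_val, smul_val, normalizer_conj_smul, Subgroup.pointwise_smul_le_pointwise_smul_iff]

lemma normalizerPCore_le_val_smul_iff [Finite G] (g : G) (x P : D.carrier) :
    normalizerPCore p (g • P).1 ≤ (g • x).1 ↔ normalizerPCore p P.1 ≤ x.1 := by
  rw [smul_val, smul_val, normalizerPCore_conj_smul, Subgroup.pointwise_smul_le_pointwise_smul_iff]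

lemma IsLowerToggle.smul {c : Set D.carrier} {P R : D.carrier} (h : IsLowerToggle c P R) (g : G) :
    IsLowerToggle (g • c) (g • P) (g • R) := by
  obtain ⟨Q, hQ, hR⟩ := h
  refine ⟨g • Q, isLeast_smul g (fun x => not_congr (val_smul_le_normalizer_iff g x P)) hQ, ?_⟩
  rw [smul_val, hR, Subgroup.smul_inf, smul_val, smul_val, normalizer_conj_smul]

lemma IsUpperToggle.smul [Finite G] {c : Set D.carrier} {P R : D.carrier}
    (h : IsUpperToggle c P R) (g : G) : IsUpperToggle (g • c) (g • P) (g • R) := by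
  obtain ⟨hc, Q, hQ, hR⟩ := h
  refine ⟨?_, g • Q,
    isGreatest_smul g (fun x => not_congr (normalizerPCore_le_val_smul_iff g x P)) hQ, ?_⟩
  · rintro _ ⟨x, hx, rfl⟩
    exact (val_smul_le_normalizer_iff g x P).2 (hc x hx)
  · rw [smul_val, hR, Subgroup.smul_sup, smul_val, smul_val, normalizerPCore_conj_smul]

lemma RadicalTog.smul [Finite G] {c : Set D.carrier} {R : D.carrier} {m : ℕ ×ₗ ℕ}
    (h : RadicalTog C c R m) (g : G) : RadicalTog C (g • c) (g • R) m := by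
  have hcard (x : D.carrier) : Nat.card (g • x).1 = Nat.card x.1 :=
    (Nat.card_congr (Subgroup.equivSMul (MulAut.conj g) x.1).toEquiv).symm
  obtain ⟨P, hP, h⟩ := h
  refine ⟨g • P, isLeast_smul g (fun x => not_congr (smul_val_mem_iff g x)) hP, ?_⟩
  rw [hcard, hcard]
  exact h.imp (And.imp_left fun h => h.smul g) (And.imp_left fun h => h.smul g)

variable {c d : Set D.carrier} {P R : D.carrier} {m : ℕ ×ₗ ℕ}

/-- Used for chains differing only in the toggled `R`, which must not compete for the role of `P`.
-/
lemma isLeast_of_forall_mem_iff {φ : D.carrier → Prop} (hcd : ∀ x, x ≠ R → (x ∈ c ↔ x ∈ d))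
    (hR : ¬ φ R ∨ P < R) (h : IsLeast {x | x ∈ c ∧ φ x} P) : IsLeast {x | x ∈ d ∧ φ x} P := by
  refine ⟨⟨(hcd P ?_).1 h.1.1, h.1.2⟩, fun x hx => ?_⟩
  · rintro rfl
    exact hR.elim (fun hR => hR h.1.2) fun hR => hR.false
  · by_cases hxR : x = R
    · subst hxR
      exact hR.elim (fun hR => absurd hx.2 hR) le_of_lt
    · exact h.2 ⟨(hcd x hxR).2 hx.1, hx.2⟩

lemma isGreatest_of_forall_mem_iff {φ : D.carrier → Prop} (hcd : ∀ x, x ≠ R → (x ∈ c ↔ x ∈ d))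
    (hR : ¬ φ R) (h : IsGreatest {x | x ∈ c ∧ φ x} P) : IsGreatest {x | x ∈ d ∧ φ x} P := by
  refine ⟨⟨(hcd P ?_).1 h.1.1, h.1.2⟩, fun x hx => h.2 ⟨(hcd x ?_).2 hx.1, hx.2⟩⟩
  · rintro rfl
    exact hR h.1.2
  · rintro rfl
    exact hR hx.2

lemma IsLowerToggle.val_le_normalizer (h : IsLowerToggle c P R) :
    R.1 ≤ Subgroup.normalizer (P.1 : Set G) := by
  obtain ⟨Q, -, hR⟩ := h
  exact hR.trans_le inf_le_right

/-- `P` is a proper subgroup of the `p`-group `Q`, so its normalizer in `Q` is strictly larger. -/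
lemma IsLowerToggle.lt [Finite G] [Fact p.Prime] (hc : IsChain (· ≤ ·) c) (hP : P ∈ c)
    (h : IsLowerToggle c P R) : P < R := by
  obtain ⟨Q, hQ, hR⟩ := h
  have hPQ : P < Q := by
    have hne : ¬ Q ≤ P := fun h => hQ.1.2 (le_trans h Subgroup.le_normalizer)
    exact ((hc.total hP hQ.1.1).resolve_right hne).lt_of_not_ge hne
  obtain ⟨k, hk, hkP, hk'⟩ := (D.isPGroup _ Q.2).exists_mem_normalizer_notMem
    (show P.1 < Q.1 from hPQ)
  change P.1 < R.1
  rw [hR]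
  exact (le_inf hPQ.le Subgroup.le_normalizer).lt_of_not_ge fun h => hkP (h ⟨hk, hk'⟩)

lemma IsUpperToggle.normalizerPCore_le (h : IsUpperToggle c P R) :
    normalizerPCore p P.1 ≤ R.1 := by
  obtain ⟨-, Q, -, hR⟩ := h
  exact le_sup_right.trans_eq hR.symm

lemma IsUpperToggle.val_le_normalizer (h : IsUpperToggle c P R) :
    R.1 ≤ Subgroup.normalizer (P.1 : Set G) := by
  obtain ⟨hc, Q, hQ, hR⟩ := h
  exact hR.trans_le (sup_le (hc Q hQ.1.1) (normalizerPCore_le_normalizer _))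

lemma IsLowerToggle.congr (hcd : ∀ x, x ≠ R → (x ∈ c ↔ x ∈ d)) (h : IsLowerToggle c P R) :
    IsLowerToggle d P R := by
  have hle := h.val_le_normalizer
  obtain ⟨Q, hQ, hR⟩ := h
  exact ⟨Q, isLeast_of_forall_mem_iff hcd (.inl (not_not.2 hle)) hQ, hR⟩

lemma IsUpperToggle.congr (hcd : ∀ x, x ≠ R → (x ∈ c ↔ x ∈ d)) (h : IsUpperToggle c P R) :
    IsUpperToggle d P R := by
  have hle := h.val_le_normalizer
  have hge := h.normalizerPCore_le
  obtain ⟨hc, Q, hQ, hR⟩ := h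
  refine ⟨fun x hx => ?_, Q, isGreatest_of_forall_mem_iff hcd (not_not.2 hge) hQ, hR⟩
  by_cases hxR : x = R
  · exact hxR ▸ hle
  · exact hc x ((hcd x hxR).2 hx)

lemma IsLowerToggle.isChain_insert (hc : IsChain (· ≤ ·) c) (h : IsLowerToggle c P R) :
    IsChain (· ≤ ·) (insert R c) := by
  obtain ⟨Q, hQ, hR⟩ := h
  refine hc.insert fun x hx _ => ?_
  by_cases hx' : x.1 ≤ Subgroup.normalizer (P.1 : Set G)
  · refine .inr ((le_inf ?_ hx').trans_eq hR.symm)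
    exact (hc.total hx hQ.1.1).resolve_right fun h => hQ.1.2 (le_trans h hx')
  · exact .inl ((hR.trans_le inf_le_left).trans (hQ.2 ⟨hx, hx'⟩))

lemma IsUpperToggle.isChain_insert (hc : IsChain (· ≤ ·) c) (h : IsUpperToggle c P R) :
    IsChain (· ≤ ·) (insert R c) := by
  obtain ⟨-, Q, hQ, hR⟩ := h
  refine hc.insert fun x hx _ => ?_
  by_cases hx' : normalizerPCore p P.1 ≤ x.1
  · refine .inl (hR.trans_le (sup_le ?_ hx'))
    exact (hc.total hQ.1.1 hx).resolve_right fun h => hQ.1.2 (hx'.trans h)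
  · exact .inr (le_trans (hQ.2 ⟨hx, hx'⟩) (le_sup_left.trans_eq hR.symm))

lemma RadicalTog.isChain_insert (hc : IsChain (· ≤ ·) c) (h : RadicalTog C c R m) :
    IsChain (· ≤ ·) (insert R c) := by
  obtain ⟨P, -, ⟨h, -⟩ | ⟨h, -⟩⟩ := h
  exacts [h.isChain_insert hc, h.isChain_insert hc]

lemma IsLowerToggle.eq {R' : D.carrier} (h : IsLowerToggle c P R) (h' : IsLowerToggle c P R') :
    R = R' := by
  obtain ⟨Q, hQ, hR⟩ := h
  obtain ⟨Q', hQ', hR'⟩ := h'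
  obtain rfl := hQ.unique hQ'
  exact Subtype.ext (hR.trans hR'.symm)

lemma IsUpperToggle.eq {R' : D.carrier} (h : IsUpperToggle c P R) (h' : IsUpperToggle c P R') :
    R = R' := by
  obtain ⟨-, Q, hQ, hR⟩ := h
  obtain ⟨-, Q', hQ', hR'⟩ := h'
  obtain rfl := hQ.unique hQ'
  exact Subtype.ext (hR.trans hR'.symm)

lemma IsLowerToggle.not_isUpperToggle {R' : D.carrier} (h : IsLowerToggle c P R) :
    ¬ IsUpperToggle c P R' := by
  obtain ⟨Q, hQ, -⟩ := h
  exact fun h' => hQ.1.2 (h'.1 Q hQ.1.1)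

end PSubgroupCollection

end RadicalToggle

/-! ### Stability and rank of the radical matching -/

section RadicalToggle

namespace PSubgroupCollection

variable {p : ℕ} {G : Type u} [Group G] [Finite G] {C D : PSubgroupCollection p G}
  {c d : Set D.carrier} {P R : D.carrier} {m : ℕ ×ₗ ℕ}

/-- In both cases `P < R`, so toggling `R` preserves `P`. As `R` normalises `P`, and in the upper
case contains `O_p(N_G(P))`, it preserves the case and `Q` as well. -/
lemma RadicalTog.congr [Fact p.Prime]
    (hCD : ∀ x : D.carrier, x.1 ∉ C.carrier → x.1 < normalizerPCore p x.1)
    (hc : IsChain (· ≤ ·) c) (hcd : ∀ x, x ≠ R → (x ∈ c ↔ x ∈ d)) (h : RadicalTog C c R m) :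
    ¬ d ⊆ {x | x.1 ∈ C.carrier} ∧ RadicalTog C d R m := by
  obtain ⟨P, hP, h⟩ := h
  have hlt : P < R := by
    obtain ⟨h, -⟩ | ⟨h, -⟩ := h
    · exact h.lt hc hP.1.1
    · exact (hCD P hP.1.2).trans_le h.normalizerPCore_le
  have hP' := isLeast_of_forall_mem_iff hcd (.inr hlt) hP
  exact ⟨fun hd => hP'.1.2 (hd hP'.1.1), P, hP',
    h.imp (And.imp_left fun h => h.congr hcd) (And.imp_left fun h => h.congr hcd)⟩

lemma exists_radicalTog [Fact p.Prime]
    (hD : ∀ P ∈ D.carrier, ∀ Q : Subgroup G, IsPGroup p Q → P ≤ Q → Q ∈ D.carrier)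
    (hCD : ∀ x : D.carrier, x.1 ∉ C.carrier → x.1 < normalizerPCore p x.1)
    (hc : IsChain (· ≤ ·) c) (hcS : ¬ c ⊆ {x | x.1 ∈ C.carrier}) :
    ∃ R m, RadicalTog C c R m := by
  have hmin {φ : D.carrier → Prop} (h : ∃ x ∈ c, φ x) : ∃ Q, IsLeast {x | x ∈ c ∧ φ x} Q := by
    obtain ⟨Q, hQ⟩ := (Set.toFinite {x | x ∈ c ∧ φ x}).exists_minimal h
    exact ⟨Q, hQ.prop, fun x hx => (hc.total hQ.prop.1 hx.1).elim id fun h => hQ.2 hx h⟩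
  have hmax {φ : D.carrier → Prop} (h : ∃ x ∈ c, φ x) : ∃ Q, IsGreatest {x | x ∈ c ∧ φ x} Q := by
    obtain ⟨Q, hQ⟩ := (Set.toFinite {x | x ∈ c ∧ φ x}).exists_maximal h
    exact ⟨Q, hQ.prop, fun x hx => (hc.total hx.1 hQ.prop.1).elim id fun h => hQ.2 hx h⟩
  obtain ⟨P, hP⟩ := hmin (Set.not_subset.1 hcS)
  by_cases h : ∃ x ∈ c, ¬ x.1 ≤ Subgroup.normalizer (P.1 : Set G)
  · obtain ⟨Q, hQ⟩ := hmin h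
    have hle : P.1 ≤ Q.1 := (hc.total hP.1.1 hQ.1.1).resolve_right fun h =>
      hQ.1.2 (le_trans h Subgroup.le_normalizer)
    exact ⟨⟨Q.1 ⊓ Subgroup.normalizer (P.1 : Set G), hD _ P.2 _
      ((D.isPGroup _ Q.2).to_le inf_le_left) (le_inf hle Subgroup.le_normalizer)⟩, _, P, hP,
      .inl ⟨⟨Q, hQ, rfl⟩, rfl⟩⟩
  · push Not at h
    -- `P` itself does not contain `O_p(N_G(P))`, so a candidate exists.
    obtain ⟨Q, hQ⟩ := hmax (φ := fun x => ¬ normalizerPCore p P.1 ≤ x.1)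
      ⟨P, hP.1.1, (hCD P hP.1.2).not_ge⟩
    exact ⟨⟨Q.1 ⊔ normalizerPCore p P.1, hD _ Q.2 _
      ((D.isPGroup _ Q.2).to_sup_of_normal_right' (isPGroup_normalizerPCore _)
        ((h Q hQ.1.1).trans (normalizer_le_normalizer_normalizerPCore _))) le_sup_left⟩, _, P, hP,
      .inr ⟨⟨h, Q, hQ, rfl⟩, rfl⟩⟩

/-- Removing `a` either raises `P`, lowering the first coordinate, or keeps it. With `P` kept, `R`
can only grow in the lower case and only shrink in the upper one, and the upper case cannot return
to the lower. The constant `2 * Nat.card G + 1` puts all lower ranks above all upper ones.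
Strictness holds because `R` stays in the new chain and `R'` is not in it. -/
lemma RadicalTog.lt [Fact p.Prime]
    (hCD : ∀ x : D.carrier, x.1 ∉ C.carrier → x.1 < normalizerPCore p x.1)
    {R' a : D.carrier} {m' : ℕ ×ₗ ℕ} (hc : IsChain (· ≤ ·) c) (hRc : R ∉ c)
    (hm : RadicalTog C c R m) (ha : a ∈ c) (hR' : R' ∉ insert R c \ {a})
    (h' : RadicalTog C (insert R c \ {a}) R' m') : m' < m := by
  have hR : R ∈ insert R c \ {a} := ⟨.inl rfl, by rintro rfl; exact hRc ha⟩
  have hne : R ≠ R' := by rintro rfl; exact hR' hR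
  obtain ⟨P', hP', h'⟩ := h'
  obtain ⟨P, hP, h⟩ := (hm.congr hCD hc (d := insert R c)
    fun x hx => ⟨.inr, fun h => h.resolve_left hx⟩).2
  have hcard (x : D.carrier) : Nat.card x.1 ≤ Nat.card G := Subgroup.card_le_card_group x.1
  have hPP' : P ≤ P' := hP.2 ⟨hP'.1.1.1, hP'.1.2⟩
  obtain rfl | hlt := hPP'.eq_or_lt
  · obtain ⟨h, rfl⟩ | ⟨h, rfl⟩ := h <;> obtain ⟨h', rfl⟩ | ⟨h', rfl⟩ := h'
    · have hlt : R < R' := by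
        refine lt_of_le_of_ne ?_ hne
        obtain ⟨Q, hQ, hR⟩ := h
        obtain ⟨Q', hQ', hR'⟩ := h'
        exact hR.trans_le ((inf_le_inf_right _ (hQ.2 ⟨hQ'.1.1.1, hQ'.1.2⟩)).trans_eq hR'.symm)
      have h1 := card_lt_card (show R.1 < R'.1 from hlt)
      have h2 := hcard R'
      exact Prod.Lex.toLex_lt_toLex.2 (.inr ⟨rfl, by lia⟩)
    · have h1 := hcard R
      have h2 := hcard R'
      have h3 : 0 < Nat.card G := Nat.card_pos
      exact Prod.Lex.toLex_lt_toLex.2 (.inr ⟨rfl, by lia⟩)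
    · obtain ⟨Q', hQ', -⟩ := h'
      exact (hQ'.1.2 (h.1 Q' hQ'.1.1.1)).elim
    · have hlt : R' < R := by
        refine lt_of_le_of_ne ?_ hne.symm
        obtain ⟨-, Q, hQ, hR⟩ := h
        obtain ⟨-, Q', hQ', hR'⟩ := h'
        exact hR'.trans_le ((sup_le_sup_right (hQ.2 ⟨hQ'.1.1.1, hQ'.1.2⟩) _).trans_eq hR.symm)
      exact Prod.Lex.toLex_lt_toLex.2 (.inr ⟨rfl, card_lt_card (show R'.1 < R.1 from hlt)⟩)
  · have h1 := card_lt_card (show P.1 < P'.1 from hlt)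
    have h2 := hcard P'
    obtain ⟨-, rfl⟩ | ⟨-, rfl⟩ := h <;> obtain ⟨-, rfl⟩ | ⟨-, rfl⟩ := h' <;>
      exact Prod.Lex.toLex_lt_toLex.2 (.inl (show _ - _ < _ - _ by lia))

/-- The matching of the chains in the poset `D` not contained in `C`, when the elements of `D` not
in `C` are not `p`-radical. -/
def radicalToggle [Fact p.Prime] (C D : PSubgroupCollection p G)
    (hD : ∀ P ∈ D.carrier, ∀ Q : Subgroup G, IsPGroup p Q → P ≤ Q → Q ∈ D.carrier)
    (hCD : ∀ x : D.carrier, x.1 ∉ C.carrier → x.1 < normalizerPCore p x.1) :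
    OrbitToggle G {x : D.carrier | x.1 ∈ C.carrier} (ℕ ×ₗ ℕ) where
  Tog := RadicalTog C
  smul_tog g _ _ _ h := h.smul g
  exists_tog hc _ hcS := exists_radicalTog hD hCD hc hcS
  unique := by
    rintro c R R' m m' - ⟨P, hP, h⟩ ⟨P', hP', h'⟩
    obtain rfl := hP.unique hP'
    suffices R = R' ∧ m = m' from ⟨this.2, 1, one_smul _ _, (one_smul _ _).trans this.1⟩
    obtain ⟨h, rfl⟩ | ⟨h, rfl⟩ := h <;> obtain ⟨h', rfl⟩ | ⟨h', rfl⟩ := h'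
    · obtain rfl := h.eq h'
      exact ⟨rfl, rfl⟩
    · exact (h.not_isUpperToggle h').elim
    · exact (h'.not_isUpperToggle h).elim
    · obtain rfl := h.eq h'
      exact ⟨rfl, rfl⟩
  tog_insert hc _ _ h := ⟨h.isChain_insert hc, _, (h.congr hCD hc fun _ hx =>
    ⟨.inr, fun h => h.resolve_left hx⟩).2⟩
  tog_erase {c R _} hc _ _ h :=
    have h' := h.congr hCD hc (d := c \ {R}) fun _ hx => ⟨fun h => ⟨h, hx⟩, fun h => h.1⟩
    ⟨h'.1, _, h'.2⟩
  lt hc _ hx h ha _ hx' h' := h.lt hCD hc hx ha hx' h'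

end PSubgroupCollection

end RadicalToggle

/-! ### Comparison of the three orbit spaces -/

lemma SSet.nonempty_iso_stdSimplex_zero {X : SSet.{u}}
    (h : ∀ n, Nonempty (Unique (X.obj n))) : Nonempty (SSet.stdSimplex.obj (.mk 0) ≅ X) := by
  let f : X ⟶ SSet.stdSimplex.obj (.mk 0) := SSet.stdSimplex.isTerminalObj₀.from X
  have : IsIso f := by
    rw [NatTrans.isIso_iff_isIso_app]
    intro n
    rw [isIso_iff_bijective]
    have := (h n).some
    have : Subsingleton ((SSet.stdSimplex.obj (.mk 0) : SSet.{u}).obj n) :=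
      (SSet.stdSimplex.objEquiv (n := .mk 0) (m := n)).subsingleton
    exact ⟨fun _ _ _ => Subsingleton.elim _ _, fun _ => ⟨default, Subsingleton.elim _ _⟩⟩
  exact ⟨(asIso f).symm⟩

section OrbitSpace

namespace PSubgroupCollection

variable {p : ℕ} {G : Type u} [Group G]

/-- The inclusion of collections of `p`-subgroups. -/
def inclusion {C D : PSubgroupCollection p G} (h : C.carrier ⊆ D.carrier) :
    C.carrier ↪o D.carrier where
  toFun := Set.inclusion h
  inj' := Set.inclusion_injective h
  map_rel_iff' := Iff.rfl

lemma range_inclusion {C D : PSubgroupCollection p G} (h : C.carrier ⊆ D.carrier) :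
    Set.range (inclusion h) = {x : D.carrier | x.1 ∈ C.carrier} :=
  Set.range_inclusion h

lemma anodyneExtensions_orbitNerveMap_inclusion [Finite G] {C D : PSubgroupCollection p G}
    (h : C.carrier ⊆ D.carrier) {α : Type*} [PartialOrder α] [WellFoundedLT α]
    (T : OrbitToggle G {x : D.carrier | x.1 ∈ C.carrier} α) :
    SSet.anodyneExtensions
      (orbitNerveMap G (inclusion h : C.carrier →o D.carrier) fun _ _ => rfl) := by
  rw [← range_inclusion h] at T
  exact T.anodyneExtensions_orbitNerveMap (f := inclusion h) (fun _ _ => rfl)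
    (ρ := fun x => Nat.card x.1) (fun _ _ hxy => card_lt_card hxy)
    fun g x => (Nat.card_congr (Subgroup.equivSMul (MulAut.conj g) x.1).toEquiv).symm

variable (p G) in
/-- The collection of the Sylow `p`-subgroups. -/
def sylowCollection : PSubgroupCollection p G where
  carrier := {P | IsMaxPSubgroup p ⊤ P}
  isPGroup _ h := h.1.1
  conj_mem g P h := by
    have h' : IsMaxPSubgroup p _ _ := IsMaxPSubgroup.smul h g
    have htop : MulAut.conj g • (⊤ : Subgroup G) = ⊤ :=
      Subgroup.map_top_of_surjective (MulAut.conj g).toMonoidHom (MulAut.conj g).surjective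
    rwa [htop] at h'

/-- The collection of the `p`-subgroups containing an element of `C`. -/
def overgroups (C : PSubgroupCollection p G) : PSubgroupCollection p G where
  carrier := {Q | IsPGroup p Q ∧ ∃ P ∈ C.carrier, P ≤ Q}
  isPGroup _ h := h.1
  conj_mem g _ := fun ⟨h, P, hP, hle⟩ =>
    ⟨h.map _, MulAut.conj g • P, C.conj_mem g P hP, Subgroup.map_mono hle⟩

variable (p G) in
/-- The orbit space of the poset of Sylow subgroups is a point. -/
lemma nonempty_unique_orbitSpace_sylowCollection [Finite G] [Fact p.Prime]
    (n : SimplexCategoryᵒᵖ) : Nonempty (Unique ((sylowCollection p G).orbitSpace.obj n)) := by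
  obtain ⟨R, -, hR⟩ := IsMaxPSubgroup.exists_le (H := (⊤ : Subgroup G))
    (IsPGroup.of_bot (p := p)) bot_le
  let x₀ : (sylowCollection p G).carrier := ⟨R, hR⟩
  -- Sylow subgroups form an antichain, so all simplices are constant.
  have heq {x y : (sylowCollection p G).carrier} (h : x ≤ y) : x = y :=
    h.antisymm (x.2.2 ⟨y.2.1.1, le_top⟩ h)
  let s₀ : (nerve (sylowCollection p G).carrier).obj n := (Functor.const _).obj x₀
  refine ⟨⟨⟨orbitMk G s₀⟩, fun q => ?_⟩⟩
  obtain ⟨s, rfl⟩ := orbitMk_surjective G q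
  obtain ⟨g, -, hg⟩ := hR.exists_smul_eq (s.obj 0).2
  refine (orbitMk_eq_iff G _ _).2 ⟨g, nerve.ext_of_isThin (funext fun i => ?_)⟩
  exact (Subtype.ext hg : g • x₀ = s.obj 0).trans (heq (s.monotone (Fin.zero_le i)))

end PSubgroupCollection

end OrbitSpace

theorem mainTheorem11 {p : ℕ} [Fact p.Prime] {G : Type u} [Group G] [Finite G]
    (C : PSubgroupCollection p G) (hne : C.carrier.Nonempty)
    (hC : C.ClosedUnderPRadicalOvergroups) :
    ContractibleSpace (SSet.toTop.obj C.orbitSpace) := by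
  obtain ⟨P₀, hP₀⟩ := hne
  have hD : ∀ P ∈ C.overgroups.carrier, ∀ Q : Subgroup G, IsPGroup p Q → P ≤ Q →
      Q ∈ C.overgroups.carrier :=
    fun P ⟨_, P', hP', hle⟩ Q hQ hPQ => ⟨hQ, P', hP', hle.trans hPQ⟩
  -- Some Sylow subgroup contains `P₀`; every other one contains a conjugate of `P₀`, again in `C`.
  have hS : (PSubgroupCollection.sylowCollection p G).carrier ⊆ C.overgroups.carrier := by
    intro R hR
    obtain ⟨R', hle, hR'⟩ := IsMaxPSubgroup.exists_le (C.isPGroup P₀ hP₀) le_top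
    obtain ⟨g, -, rfl⟩ := hR'.exists_smul_eq hR
    exact ⟨hR.1.1, _, C.conj_mem g P₀ hP₀, Subgroup.map_mono hle⟩
  have hCD : C.carrier ⊆ C.overgroups.carrier := fun P hP => ⟨C.isPGroup P hP, P, hP, le_rfl⟩
  have h1 := PSubgroupCollection.anodyneExtensions_orbitNerveMap_inclusion hS
    (PSubgroupCollection.sylowToggle C.overgroups hD)
  have h2 := PSubgroupCollection.anodyneExtensions_orbitNerveMap_inclusion hCD
    -- The closure hypothesis enters only here: a `p`-radical overgroup of a member of `C` would lie
    -- in `C`.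
    (PSubgroupCollection.radicalToggle C C.overgroups hD fun x hx =>
      lt_normalizerPCore_of_not_isPRadicalSubgroup x.2.1 fun hrad => by
        obtain ⟨P, hP, hle⟩ := x.2.2
        exact hx (hC P hP x.1 hle hrad))
  have : ContractibleSpace (SSet.toTop.obj (orbitNerve G C.overgroups.carrier)) := by
    obtain ⟨e⟩ := SSet.nonempty_iso_stdSimplex_zero
      (PSubgroupCollection.nonempty_unique_orbitSpace_sylowCollection p G)
    exact contractibleSpace_toTop_of_anodyneExtensions _
      ((SSet.anodyneExtensions.cancel_left_of_respectsIso e.hom _).2 h1)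
  exact contractibleSpace_toTop_left_of_anodyneExtensions _ h2
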